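/- For an integer $n \ge 1$ let $\mathrm{Li}_n$ denote the principal branch of the polylogarithm, that is, the analytic continuation of $\mathrm{Li}_n(z)=\sum_{k=1}^{\infty} \frac{z^k}{k^n}$ ($|z|<1$) to the cut plane $\mathbb{C}\setminus[1,\infty)$. Then $$\Re\,\mathrm{Li}_4(1+i) = -\frac{5}{16}\,\mathrm{Li}_4\!\left(\tfrac12\right) + \frac{97\pi^4}{9216} - \frac{5\log^4 2}{384} + \frac{\pi^2\log^2 2}{48}$$ and $$\Re\,\mathrm{Li}_4\!\left(\tfrac12+\tfrac{i}{2}\right) = \sum_{k=1}^{\infty} \frac{\sum_{l=0}^{\lfloor k/2\rfloor} (-1)^l \binom{k}{2l}}{k^4\,2^k} = \frac{5}{16}\,\mathrm{Li}_4\!\left(\tfrac12\right) + \frac{343\pi^4}{92160} + \frac{\log^4 2}{96} - \frac{5\pi^2\log^2 2}{768}.$$ -/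

import Mathlib

open Set MeasureTheory

/-- The complex plane cut along the real half-line `[1, ∞)`: the domain of the principal branch of
the polylogarithms. -/
def polylogDomain : Set ℂ := {z : ℂ | 1 - z ∈ Complex.slitPlane}

/-- `f` is, on the cut plane `ℂ \ [1, ∞)`, the analytic continuation of the power series
`∑_{k ≥ 1} z ^ k / k ^ n`, which converges for `|z| < 1`. -/
structure IsPolylog (n : ℕ) (f : ℂ → ℂ) : Prop where
  differentiableOn : DifferentiableOn ℂ f polylogDomain
  hasSum : ∀ z : ℂ, ‖z‖ < 1 → HasSum (fun k : ℕ => z ^ (k + 1) / ((k : ℂ) + 1) ^ n) (f z)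

theorem mem_polylogDomain_iff {z : ℂ} : z ∈ polylogDomain ↔ z.re < 1 ∨ z.im ≠ 0 := by
  simp [polylogDomain, Complex.mem_slitPlane_iff]

theorem isOpen_polylogDomain : IsOpen polylogDomain :=
  Complex.isOpen_slitPlane.preimage (continuous_const.sub continuous_id)

theorem starConvex_polylogDomain : StarConvex ℝ 0 polylogDomain := by
  rw [starConvex_zero_iff]
  intro z hz t h0 h1
  rw [mem_polylogDomain_iff] at hz ⊢
  rcases h0.eq_or_lt with rfl | h0
  · simp
  · rcases hz with hz | hz
    · left
      simp only [Complex.real_smul, Complex.mul_re, Complex.ofReal_re, Complex.ofReal_im]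
      nlinarith
    · right
      simpa [h0.ne'] using hz

theorem ofReal_mul_mem_polylogDomain {z : ℂ} (hz : z ∈ polylogDomain) {t : ℝ} (h0 : 0 ≤ t)
    (h1 : t ≤ 1) : (t : ℂ) * z ∈ polylogDomain := by
  simpa using starConvex_polylogDomain.smul_mem hz h0 h1

theorem mem_polylogDomain_of_norm_lt_one {z : ℂ} (hz : ‖z‖ < 1) : z ∈ polylogDomain :=
  mem_polylogDomain_iff.2 (Or.inl ((Complex.re_le_norm z).trans_lt hz))

theorem differentiableOn_integral_mul {g : ℂ → ℂ} (hg : DifferentiableOn ℂ g polylogDomain) :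
    DifferentiableOn ℂ (fun z => ∫ t in (0 : ℝ)..1, g (t * z)) polylogDomain := by
  intro z₀ hz₀
  obtain ⟨r, hr, hball⟩ := Metric.nhds_basis_closedBall.mem_iff.1
    (isOpen_polylogDomain.mem_nhds hz₀)
  have hd : ContinuousOn (deriv g) polylogDomain :=
    (hg.deriv isOpen_polylogDomain).continuousOn
  have hK : IsCompact ((fun p : ℝ × ℂ => (p.1 : ℂ) * p.2) ''
      (Icc (0 : ℝ) 1 ×ˢ Metric.closedBall z₀ r)) :=
    (isCompact_Icc.prod (isCompact_closedBall z₀ r)).image (by fun_prop)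
  have hKU : ((fun p : ℝ × ℂ => (p.1 : ℂ) * p.2) ''
      (Icc (0 : ℝ) 1 ×ˢ Metric.closedBall z₀ r)) ⊆ polylogDomain := by
    rintro _ ⟨⟨t, z⟩, ⟨ht, hz⟩, rfl⟩
    exact ofReal_mul_mem_polylogDomain (hball hz) ht.1 ht.2
  obtain ⟨C, hC⟩ := hK.exists_bound_of_continuousOn (hd.mono hKU)
  have hmaps : ∀ z ∈ polylogDomain, MapsTo (fun t : ℝ => (t : ℂ) * z) (uIcc 0 1) polylogDomain := by
    intro z hz t ht
    rw [uIcc_of_le zero_le_one] at ht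
    exact ofReal_mul_mem_polylogDomain hz ht.1 ht.2
  have hint : ∀ z ∈ polylogDomain,
      ContinuousOn (fun t : ℝ => g (t * z)) (uIcc 0 1) := fun z hz =>
    hg.continuousOn.comp (by fun_prop) (hmaps z hz)
  have hint' : ContinuousOn (fun t : ℝ => (t : ℂ) * deriv g (t * z₀)) (uIcc 0 1) :=
    (by fun_prop : ContinuousOn (fun t : ℝ => (t : ℂ)) (uIcc 0 1)).mul
      (hd.comp (by fun_prop) (hmaps z₀ hz₀))
  refine (intervalIntegral.hasDerivAt_integral_of_dominated_loc_of_deriv_le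
    (F := fun z (t : ℝ) => g (t * z)) (F' := fun z (t : ℝ) => (t : ℂ) * deriv g (t * z))
    (bound := fun _ => C) (Metric.closedBall_mem_nhds z₀ hr) ?_ ?_ ?_ ?_ ?_
    ?_).2.differentiableAt.differentiableWithinAt
  · filter_upwards [isOpen_polylogDomain.mem_nhds hz₀] with z hz
    exact (hint z hz).intervalIntegrable.def'.aestronglyMeasurable
  · exact (hint z₀ hz₀).intervalIntegrable
  · exact hint'.intervalIntegrable.def'.aestronglyMeasurable
  · refine Filter.Eventually.of_forall fun t ht z hz => ?_
    rw [uIoc_of_le zero_le_one] at ht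
    have h1 := hC _ ⟨(t, z), ⟨⟨ht.1.le, ht.2⟩, hz⟩, rfl⟩
    have h2 : ‖(t : ℂ)‖ ≤ 1 := by
      rw [Complex.norm_real, Real.norm_eq_abs, abs_of_pos ht.1]
      exact ht.2
    rw [norm_mul]
    calc ‖(t : ℂ)‖ * ‖deriv g (t * z)‖ ≤ 1 * C :=
          mul_le_mul h2 h1 (norm_nonneg _) zero_le_one
      _ = C := one_mul C
  · exact intervalIntegrable_const
  · refine Filter.Eventually.of_forall fun t ht z hz => ?_
    rw [uIoc_of_le zero_le_one] at ht
    have hm := ofReal_mul_mem_polylogDomain (hball hz) ht.1.le ht.2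
    have h1 : HasDerivAt g (deriv g (t * z)) (t * z) :=
      (hg.differentiableAt (isOpen_polylogDomain.mem_nhds hm)).hasDerivAt
    have h2 : HasDerivAt (fun z : ℂ => (t : ℂ) * z) (t : ℂ) z := by
      simpa using (hasDerivAt_id z).const_mul (t : ℂ)
    have h3 := h1.comp z h2
    rw [mul_comm] at h3
    exact h3

theorem hasSum_integral_mul {g : ℂ → ℂ} {n : ℕ}
    (hg : ∀ z : ℂ, ‖z‖ < 1 → HasSum (fun k : ℕ => z ^ k / ((k : ℂ) + 1) ^ n) (g z))
    {z : ℂ} (hz : ‖z‖ < 1) :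
    HasSum (fun k : ℕ => z ^ k / ((k : ℂ) + 1) ^ (n + 1)) (∫ t in (0 : ℝ)..1, g (t * z)) := by
  have hterm : ∀ k : ℕ, ∫ t in (0 : ℝ)..1, ((t : ℂ) * z) ^ k / ((k : ℂ) + 1) ^ n
      = z ^ k / ((k : ℂ) + 1) ^ (n + 1) := by
    intro k
    have h1 : ∀ t : ℝ, ((t : ℂ) * z) ^ k / ((k : ℂ) + 1) ^ n
        = ((t ^ k : ℝ) : ℂ) * (z ^ k / ((k : ℂ) + 1) ^ n) := by
      intro t
      push_cast
      ring
    have hk : (k : ℂ) + 1 ≠ 0 := Nat.cast_add_one_ne_zero k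
    simp_rw [h1]
    rw [intervalIntegral.integral_mul_const, intervalIntegral.integral_ofReal, integral_pow]
    push_cast
    field_simp
    simp
    ring
  simp_rw [← hterm]
  refine intervalIntegral.hasSum_integral_of_dominated_convergence
    (fun k _ => ‖z‖ ^ k) ?_ ?_ ?_ ?_ ?_
  · intro k
    exact (by fun_prop : Continuous fun t : ℝ =>
      ((t : ℂ) * z) ^ k / ((k : ℂ) + 1) ^ n).aestronglyMeasurable
  · refine fun k => Filter.Eventually.of_forall fun t ht => ?_
    rw [uIoc_of_le zero_le_one] at ht
    have h2 : ‖(t : ℂ)‖ ≤ 1 := by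
      rw [Complex.norm_real, Real.norm_eq_abs, abs_of_pos ht.1]
      exact ht.2
    have h3 : ‖(k : ℂ) + 1‖ = (k : ℝ) + 1 := by
      exact_mod_cast Complex.norm_natCast (k + 1)
    rw [norm_div, norm_pow, norm_pow, norm_mul, h3]
    refine (div_le_self (by positivity) (one_le_pow₀ (by
      have := Nat.cast_nonneg (α := ℝ) k
      linarith))).trans ?_
    exact pow_le_pow_left₀ (by positivity) (mul_le_of_le_one_left (norm_nonneg z) h2) k
  · exact Filter.Eventually.of_forall fun t _ => summable_geometric_of_lt_one (norm_nonneg z) hz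
  · exact intervalIntegrable_const
  · refine Filter.Eventually.of_forall fun t ht => hg _ ?_
    rw [uIoc_of_le zero_le_one] at ht
    rw [norm_mul, Complex.norm_real, Real.norm_eq_abs, abs_of_pos ht.1]
    exact (mul_le_of_le_one_left (norm_nonneg z) ht.2).trans_lt hz

theorem exists_polylog_div (n : ℕ) : ∃ g : ℂ → ℂ, DifferentiableOn ℂ g polylogDomain ∧
    ∀ z : ℂ, ‖z‖ < 1 → HasSum (fun k : ℕ => z ^ k / ((k : ℂ) + 1) ^ n) (g z) := by
  induction n with
  | zero =>
    refine ⟨fun z => (1 - z)⁻¹, ?_, fun z hz => ?_⟩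
    · intro z hz
      have h : 1 - z ≠ 0 := Complex.slitPlane_ne_zero hz
      exact ((differentiableAt_id.const_sub (1 : ℂ)).inv h).differentiableWithinAt
    · simpa using hasSum_geometric_of_norm_lt_one hz
  | succ n ih =>
    obtain ⟨g, hg, hs⟩ := ih
    exact ⟨_, differentiableOn_integral_mul hg, fun z hz => hasSum_integral_mul hs hz⟩

/-- The analytic continuation of the polylogarithm series to the cut plane exists. -/
theorem exists_isPolylog (n : ℕ) : ∃ f : ℂ → ℂ, IsPolylog n f := by
  obtain ⟨g, hg, hs⟩ := exists_polylog_div n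
  refine ⟨fun z => z * g z, differentiableOn_id.mul hg, fun z hz => ?_⟩
  have h := (hs z hz).mul_left z
  refine h.congr_fun ?_
  intro k
  ring

/-- The analytic continuation of the polylogarithm series to the cut plane is unique. -/
theorem IsPolylog.eqOn {n : ℕ} {f g : ℂ → ℂ} (hf : IsPolylog n f) (hg : IsPolylog n g) :
    EqOn f g polylogDomain := by
  have h0 : (0 : ℂ) ∈ polylogDomain := mem_polylogDomain_of_norm_lt_one (by simp)
  refine (hf.differentiableOn.analyticOnNhd
    isOpen_polylogDomain).eqOn_of_preconnected_of_eventuallyEq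
    (hg.differentiableOn.analyticOnNhd isOpen_polylogDomain)
    (starConvex_polylogDomain.isPathConnected h0).isConnected.isPreconnected h0 ?_
  filter_upwards [Metric.ball_mem_nhds (0 : ℂ) one_pos] with z hz
  have hz' : ‖z‖ < 1 := by simpa using hz
  exact (hf.hasSum z hz').unique (hg.hasSum z hz')

/-- The (principal branch of the) polylogarithm `Li_n`: the analytic continuation of
`∑_{k ≥ 1} z ^ k / k ^ n` to `ℂ \ [1, ∞)`. Its values on the cut `[1, ∞)` are unspecified. -/
noncomputable def polylog (n : ℕ) : ℂ → ℂ := Classical.choose (exists_isPolylog n)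

theorem isPolylog_polylog (n : ℕ) : IsPolylog n (polylog n) :=
  Classical.choose_spec (exists_isPolylog n)

/-! Both closed forms are identities between iterated integrals. `divPrim` integrates `g(s)/s` from
`0`, so each polylogarithm is `divPrim` of the preceding one, and the same operator applied to
powers of `log (1 - s)` gives the auxiliary functions `logSqPrim`, `logCubePrim` and `logSqPrim₂`. A
functional equation is proved by checking that the difference of its sides has derivative zero on a
connected domain, and by finding the constant at one point or as a limit at a boundary point.

By conjugation symmetry, twice the first real part is `Li₄(1+i) + Li₄(1-i)`. These two values enter
through `logCubePrim (±i)`, since integration by parts (`logCubePrim_eq`) expresses `logCubePrim z`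
by polylogarithms at `1 - z`. The value `Li₄(1/2)` enters through `logCubePrim (-1)` and `logSqPrim₂
(-1)`, obtained from `1/2` by the Landen substitution.

The link between them is `evenLogCubePrim_cayley`. Put `q = log (1+z) - log (1-z)`, `η = πi/2` and
`ℓ = log z - η`. In the upper half-plane, the sum of `evenLogCubePrim` over the two points
`(1-z)/(1+z)` and `(1+z)/(1-z)`, corrected by a multiple of `oddLogSqPrim`, has derivative `2(ℓ² -
η²)(q - η)q'`. This has an explicit primitive built from weight-four products, `evenLogSqPrim`,
`evenLogSqPrim₂` and `oddPolylog`. At `z = i` the two points are `-i` and `i`, and `ℓ = 0`. The one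
unknown left of a new kind, `evenLogSqPrim₂ i`, is supplied by a second symmetry,
`evenLogSqPrim_cayley`, also at `z = i`. What remains are the conjugate sums of `Li₂` and `Li₃` at
`1 ± i`, given by the classical functional equations, and an odd combination of `Li₃(±i)`, given by
inversion.

The second value follows from the first by the inversion formula for `Li₄`, because `(1+i)⁻¹ =
(1-i)/2`; its series is the real part of the defining power series. -/

/-! ### Integration against `ds/s` from the origin -/

/-- The primitive `∫_0^z g(s) / s ds` along the segment from `0` to `z`, for `g` vanishing at `0`. -/
noncomputable def divPrim (g : ℂ → ℂ) (z : ℂ) : ℂ :=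
  z * ∫ t in (0 : ℝ)..1, dslope g 0 (t * z)

theorem zero_mem_polylogDomain : (0 : ℂ) ∈ polylogDomain :=
  mem_polylogDomain_of_norm_lt_one (by simp)

theorem isPreconnected_polylogDomain : IsPreconnected polylogDomain :=
  (starConvex_polylogDomain.isPathConnected zero_mem_polylogDomain).isConnected.isPreconnected

theorem differentiableOn_dslope_polylogDomain {g : ℂ → ℂ} (hg : DifferentiableOn ℂ g polylogDomain) :
    DifferentiableOn ℂ (dslope g 0) polylogDomain :=
  (Complex.differentiableOn_dslope (isOpen_polylogDomain.mem_nhds zero_mem_polylogDomain)).2 hg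

@[simp] theorem divPrim_zero (g : ℂ → ℂ) : divPrim g 0 = 0 := by simp [divPrim]

theorem differentiableOn_divPrim {g : ℂ → ℂ} (hg : DifferentiableOn ℂ g polylogDomain) :
    DifferentiableOn ℂ (divPrim g) polylogDomain :=
  differentiableOn_id.mul (differentiableOn_integral_mul (differentiableOn_dslope_polylogDomain hg))

/-- Holomorphy is already known, so away from `0` the derivative can be computed in a single
direction. Along the ray `r ↦ r z`, rescaling turns `divPrim g (r z)` into an integral with variable
endpoint `r`, and the fundamental theorem of calculus applies at `r = 1`. At `0` the product rule
suffices. -/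
theorem hasDerivAt_divPrim_dslope {g : ℂ → ℂ} (hg : DifferentiableOn ℂ g polylogDomain)
    {z : ℂ} (hz : z ∈ polylogDomain) : HasDerivAt (divPrim g) (dslope g 0 z) z := by
  have hh := differentiableOn_dslope_polylogDomain hg
  rcases eq_or_ne z 0 with rfl | h0
  · have h1 := (hasDerivAt_id (0 : ℂ)).mul (((differentiableOn_integral_mul hh).differentiableAt
      (isOpen_polylogDomain.mem_nhds hz)).hasDerivAt)
    exact h1.congr_deriv (by simp)
  · have h1 := ((differentiableOn_divPrim hg).differentiableAt
      (isOpen_polylogDomain.mem_nhds hz)).hasDerivAt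
    have hU : IsOpen {s : ℝ | (s : ℂ) * z ∈ polylogDomain} :=
      isOpen_polylogDomain.preimage (by fun_prop)
    have hc : ContinuousOn (fun s : ℝ => dslope g 0 (s * z)) {s : ℝ | (s : ℂ) * z ∈ polylogDomain} :=
      hh.continuousOn.comp (by fun_prop) fun s hs => hs
    have hmem : (1 : ℝ) ∈ {s : ℝ | (s : ℂ) * z ∈ polylogDomain} := by simpa using hz
    have h2 : HasDerivAt (fun r : ℝ => z * ∫ s in (0 : ℝ)..r, dslope g 0 (s * z))
        (z * dslope g 0 ((1 : ℝ) * z)) 1 := by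
      refine HasDerivAt.const_mul z (intervalIntegral.integral_hasDerivAt_right ?_ ?_ ?_)
      · refine (hc.mono fun s hs => ?_).intervalIntegrable
        rw [uIcc_of_le zero_le_one] at hs
        exact ofReal_mul_mem_polylogDomain hz hs.1 hs.2
      · exact hc.stronglyMeasurableAtFilter hU _ hmem
      · exact hc.continuousAt (hU.mem_nhds hmem)
    have h3 : (fun r : ℝ => z * ∫ s in (0 : ℝ)..r, dslope g 0 (s * z))
        = fun r : ℝ => divPrim g (r * z) := by
      funext r
      have := intervalIntegral.smul_integral_comp_mul_right (a := 0) (b := 1)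
        (fun s : ℝ => dslope g 0 (s * z)) r
      rw [zero_mul, one_mul] at this
      rw [← this, divPrim, Complex.real_smul]
      push_cast
      simp only [mul_assoc]
      ring
    rw [h3] at h2
    have h4 : HasDerivAt (fun r : ℝ => divPrim g (r * z)) (deriv (divPrim g) z * z) 1 := by
      have h5 : HasDerivAt (fun r : ℂ => r * z) z ((1 : ℝ) : ℂ) := by
        simpa using (hasDerivAt_id ((1 : ℝ) : ℂ)).mul_const z
      have h6 : HasDerivAt (divPrim g) (deriv (divPrim g) z) (((1 : ℝ) : ℂ) * z) := by simpa using h1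
      exact (HasDerivAt.comp (h₂ := divPrim g) (h := fun r : ℂ => r * z) _ h6 h5).comp_ofReal
    have h7 := h4.unique h2
    rw [Complex.ofReal_one, one_mul, mul_comm] at h7
    rwa [mul_left_cancel₀ h0 h7] at h1

theorem hasDerivAt_divPrim {g : ℂ → ℂ} (hg : DifferentiableOn ℂ g polylogDomain) (hg0 : g 0 = 0)
    {z : ℂ} (hz : z ∈ polylogDomain) (h0 : z ≠ 0) : HasDerivAt (divPrim g) (g z / z) z := by
  have h := hasDerivAt_divPrim_dslope hg hz
  rwa [dslope_of_ne _ h0, slope_def_field, hg0, sub_zero, sub_zero] at h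

theorem conj_mem_polylogDomain {z : ℂ} (hz : z ∈ polylogDomain) :
    (starRingEnd ℂ) z ∈ polylogDomain := by
  rw [mem_polylogDomain_iff] at hz ⊢
  simpa using hz

/-- Conjugating before and after `divPrim g` gives a holomorphic function with the same derivative,
and both functions vanish at `0`. -/
theorem divPrim_conj {g : ℂ → ℂ} (hg : DifferentiableOn ℂ g polylogDomain) (hg0 : g 0 = 0)
    (hc : ∀ z ∈ polylogDomain, g ((starRingEnd ℂ) z) = (starRingEnd ℂ) (g z))
    {z : ℂ} (hz : z ∈ polylogDomain) :
    divPrim g ((starRingEnd ℂ) z) = (starRingEnd ℂ) (divPrim g z) := by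
  have hd : ∀ z ∈ polylogDomain, HasDerivAt
      ((starRingEnd ℂ) ∘ divPrim g ∘ (starRingEnd ℂ)) (dslope g 0 z) z := by
    intro z hz
    have h := (hasDerivAt_divPrim_dslope hg (conj_mem_polylogDomain hz)).conj_conj
    rw [Complex.conj_conj] at h
    refine h.congr_deriv (Eq.symm ?_)
    rcases eq_or_ne z 0 with rfl | h0
    · rw [map_zero, dslope_same]
      have : g =ᶠ[nhds 0] (starRingEnd ℂ) ∘ g ∘ (starRingEnd ℂ) := by
        filter_upwards [isOpen_polylogDomain.mem_nhds zero_mem_polylogDomain] with z hz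
        simp [hc z hz]
      have h2 := this.deriv_eq
      rw [deriv_conj_conj] at h2
      simpa using h2
    · have h1 : (starRingEnd ℂ) z ≠ 0 := by simpa using h0
      rw [dslope_of_ne _ h0, dslope_of_ne _ h1, slope_def_field, slope_def_field, hg0, hc z hz]
      simp
  have := isOpen_polylogDomain.eqOn_of_deriv_eq isPreconnected_polylogDomain
    (f := (starRingEnd ℂ) ∘ divPrim g ∘ (starRingEnd ℂ)) (g := divPrim g)
    (fun z hz => (hd z hz).differentiableAt.differentiableWithinAt)
    (differentiableOn_divPrim hg)
    (fun z hz => (hd z hz).deriv.trans (hasDerivAt_divPrim_dslope hg hz).deriv.symm)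
    zero_mem_polylogDomain (by simp) hz
  rw [← this]
  simp

/-- Term-by-term integration along the segment, dominated by the series at radius `‖z‖`. The
arbitrary index type and exponents also cover the double series coming from `log (1 - z) ^ 2`. -/
theorem hasSum_divPrim {ι : Type*} [Countable ι] {g : ℂ → ℂ} (hg0 : g 0 = 0) {c : ι → ℂ} {e : ι → ℕ}
    (hs : ∀ r : ℝ, 0 ≤ r → r < 1 → Summable fun i => ‖c i‖ * r ^ e i)
    (hg : ∀ z : ℂ, ‖z‖ < 1 → HasSum (fun i => c i * z ^ (e i + 1)) (g z))
    {z : ℂ} (hz : ‖z‖ < 1) :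
    HasSum (fun i => c i / ((e i : ℂ) + 1) * z ^ (e i + 1)) (divPrim g z) := by
  rcases eq_or_ne z 0 with rfl | h0
  · simp
  have hterm : ∀ i, ∫ t in (0 : ℝ)..1, c i * ((t : ℂ) * z) ^ e i
      = c i / ((e i : ℂ) + 1) * z ^ e i := by
    intro i
    have h1 : ∀ t : ℝ, c i * ((t : ℂ) * z) ^ e i = ((t ^ e i : ℝ) : ℂ) * (c i * z ^ e i) := by
      intro t
      push_cast
      ring
    simp_rw [h1]
    rw [intervalIntegral.integral_mul_const, intervalIntegral.integral_ofReal, integral_pow]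
    push_cast
    simp
    ring
  have key : HasSum (fun i => c i / ((e i : ℂ) + 1) * z ^ e i)
      (∫ t in (0 : ℝ)..1, dslope g 0 (t * z)) := by
    simp_rw [← hterm]
    have hle : ∀ t ∈ uIoc (0 : ℝ) 1, ‖(t : ℂ) * z‖ ≤ ‖z‖ := by
      intro t ht
      rw [uIoc_of_le zero_le_one] at ht
      rw [norm_mul, Complex.norm_real, Real.norm_eq_abs, abs_of_pos ht.1]
      exact mul_le_of_le_one_left (norm_nonneg z) ht.2
    refine intervalIntegral.hasSum_integral_of_dominated_convergence
      (fun i _ => ‖c i‖ * ‖z‖ ^ e i) ?_ ?_ ?_ ?_ ?_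
    · intro i
      exact (by fun_prop : Continuous fun t : ℝ => c i * ((t : ℂ) * z) ^ e i).aestronglyMeasurable
    · refine fun i => Filter.Eventually.of_forall fun t ht => ?_
      rw [norm_mul, norm_pow]
      gcongr
      exact hle t ht
    · exact Filter.Eventually.of_forall fun t _ => hs _ (norm_nonneg z) hz
    · exact intervalIntegrable_const
    · refine Filter.Eventually.of_forall fun t ht => ?_
      have h2 := hg _ ((hle t ht).trans_lt hz)
      rw [uIoc_of_le zero_le_one] at ht
      -- The interval is open at `0`, so `dslope` is the ordinary quotient at every point that
      -- matters.
      have h3 : (t : ℂ) * z ≠ 0 := mul_ne_zero (by exact_mod_cast ht.1.ne') h0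
      rw [dslope_of_ne _ h3, slope_def_field, hg0, sub_zero, sub_zero]
      refine (h2.div_const _).congr_fun fun i => ?_
      rw [pow_succ, ← mul_assoc, mul_div_cancel_right₀ _ h3]
  rw [divPrim]
  refine (key.mul_left z).congr_fun fun i => ?_
  ring

theorem isPolylog_divPrim {n : ℕ} {f : ℂ → ℂ} (hf : IsPolylog n f) : IsPolylog (n + 1) (divPrim f) := by
  have h0 : f 0 = 0 := by
    have := hf.hasSum 0 (by simp)
    simpa using this.unique (by simp)
  refine ⟨differentiableOn_divPrim hf.differentiableOn, fun z hz => ?_⟩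
  have := hasSum_divPrim (c := fun k : ℕ => 1 / ((k : ℂ) + 1) ^ n) (e := fun k => k) h0 ?_ ?_ hz
  · refine this.congr_fun fun k => ?_
    have : (k : ℂ) + 1 ≠ 0 := Nat.cast_add_one_ne_zero k
    field_simp
    ring
  · intro r hr hr1
    refine Summable.of_nonneg_of_le (fun k => by positivity) (fun k => ?_)
      (summable_geometric_of_lt_one hr hr1)
    refine mul_le_of_le_one_left (by positivity) ?_
    have h3 : ‖(k : ℂ) + 1‖ = (k : ℝ) + 1 := by
      exact_mod_cast Complex.norm_natCast (k + 1)
    rw [norm_div, norm_pow, norm_one, h3]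
    refine div_le_one_of_le₀ (one_le_pow₀ ?_) (by positivity)
    have := Nat.cast_nonneg (α := ℝ) k
    linarith
  · intro z hz
    refine (hf.hasSum z hz).congr_fun fun k => ?_
    ring

/-! ### Constancy of analytic functions -/

/-- The derivative formulas used below contain `1/z` and are available only off the origin;
continuity of the derivative of a holomorphic function fills in the point `0`. -/
theorem eq_of_hasDerivAt_zero {U : Set ℂ} (hU : IsOpen U) (hc : IsPreconnected U) {F : ℂ → ℂ}
    (hF : DifferentiableOn ℂ F U) (h : ∀ z ∈ U, z ≠ 0 → HasDerivAt F 0 z) {x y : ℂ} (hx : x ∈ U)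
    (hy : y ∈ U) : F x = F y := by
  refine hU.is_const_of_deriv_eq_zero hc hF (fun z hz => ?_) hx hy
  rcases eq_or_ne z 0 with rfl | h0
  · have h1 : Filter.Tendsto (deriv F) (nhdsWithin 0 {0}ᶜ) (nhds (deriv F 0)) :=
      (((hF.deriv hU).differentiableAt (hU.mem_nhds hz)).continuousAt).tendsto.mono_left
        nhdsWithin_le_nhds
    refine tendsto_nhds_unique (h1.congr' ?_) tendsto_const_nhds
    filter_upwards [nhdsWithin_le_nhds (hU.mem_nhds hz), self_mem_nhdsWithin] with w hw hw0
    exact (h w hw hw0).deriv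
  · exact (h z hz h0).deriv

/-- For equations whose natural normalisation point lies on the boundary of the domain: the constant
is read off as a limit along some path inside it. -/
theorem eq_of_tendsto_of_hasDerivAt_zero {U : Set ℂ} (hU : IsOpen U) (hc : IsPreconnected U)
    {F : ℂ → ℂ} (h : ∀ z ∈ U, HasDerivAt F 0 z) {ι : Type*} {l : Filter ι} [l.NeBot] {φ : ι → ℂ}
    (hφ : ∀ᶠ i in l, φ i ∈ U) {c : ℂ} (hl : Filter.Tendsto (fun i => F (φ i)) l (nhds c))
    {z : ℂ} (hz : z ∈ U) : F z = c := by
  refine tendsto_nhds_unique (Filter.Tendsto.congr' ?_ tendsto_const_nhds) hl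
  filter_upwards [hφ] with i hi
  exact eq_of_hasDerivAt_zero hU hc
    (fun z hz => (h z hz).differentiableAt.differentiableWithinAt) (fun z hz _ => h z hz) hz hi

/-! ### Domains -/

/-- The complex plane cut along `(-∞, 0]` and `[1, ∞)`. -/
def cutPlane₀₁ : Set ℂ := polylogDomain ∩ Complex.slitPlane

/-- The complex plane cut along `(-∞, -1]` and `[1, ∞)`. -/
def cutPlanePM : Set ℂ := {z | z ∈ polylogDomain ∧ -z ∈ polylogDomain}

theorem mem_cutPlane₀₁_iff {z : ℂ} : z ∈ cutPlane₀₁ ↔ (0 < z.re ∧ z.re < 1) ∨ z.im ≠ 0 := by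
  rw [cutPlane₀₁, mem_inter_iff, mem_polylogDomain_iff, Complex.mem_slitPlane_iff]
  tauto

theorem mem_cutPlanePM_iff {z : ℂ} : z ∈ cutPlanePM ↔ (-1 < z.re ∧ z.re < 1) ∨ z.im ≠ 0 := by
  rw [cutPlanePM, mem_ofPred_eq, mem_polylogDomain_iff, mem_polylogDomain_iff, Complex.neg_re,
    Complex.neg_im, neg_lt, neg_ne_zero]
  tauto

theorem isOpen_cutPlane₀₁ : IsOpen cutPlane₀₁ := isOpen_polylogDomain.inter Complex.isOpen_slitPlane

theorem isOpen_cutPlanePM : IsOpen cutPlanePM :=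
  isOpen_polylogDomain.inter (isOpen_polylogDomain.preimage continuous_neg)

theorem isPreconnected_cutPlane₀₁ : IsPreconnected cutPlane₀₁ := by
  have h : StarConvex ℝ (1 / 2 : ℂ) cutPlane₀₁ := by
    intro z hz s t hs ht hst
    rw [mem_cutPlane₀₁_iff] at hz ⊢
    rcases ht.eq_or_lt with rfl | ht
    · left
      have : s = 1 := by linarith
      subst this
      norm_num
    · rcases hz with hz | hz
      · left
        norm_num
        constructor <;> nlinarith
      · right
        simpa [ht.ne'] using hz
  exact (h.isPathConnected (mem_cutPlane₀₁_iff.2 (by norm_num))).isConnected.isPreconnected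

theorem zero_mem_cutPlanePM : (0 : ℂ) ∈ cutPlanePM := mem_cutPlanePM_iff.2 (by norm_num)

theorem isPreconnected_cutPlanePM : IsPreconnected cutPlanePM := by
  have h : StarConvex ℝ (0 : ℂ) cutPlanePM := by
    rw [starConvex_zero_iff]
    intro z hz t h0 h1
    have h2 := fun h => ofReal_mul_mem_polylogDomain (z := z) h h0 h1
    have h3 := fun h => ofReal_mul_mem_polylogDomain (z := -z) h h0 h1
    rw [mul_neg] at h3
    rw [Complex.real_smul]
    exact ⟨h2 hz.1, h3 hz.2⟩
  exact (h.isPathConnected zero_mem_cutPlanePM).isConnected.isPreconnected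

theorem one_sub_ne_zero_of_mem {z : ℂ} (hz : z ∈ polylogDomain) : 1 - z ≠ 0 :=
  Complex.slitPlane_ne_zero hz

theorem one_add_ne_zero_of_mem {z : ℂ} (hz : z ∈ cutPlanePM) : 1 + z ≠ 0 := by
  simpa using one_sub_ne_zero_of_mem hz.2

theorem one_add_mem_slitPlane {z : ℂ} (hz : z ∈ cutPlanePM) : 1 + z ∈ Complex.slitPlane := by
  have := hz.2
  rwa [polylogDomain, mem_ofPred_eq, sub_neg_eq_add] at this

theorem cutPlane₀₁_subset_cutPlanePM : cutPlane₀₁ ⊆ cutPlanePM := by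
  intro z hz
  rw [mem_cutPlane₀₁_iff] at hz
  rw [mem_cutPlanePM_iff]
  rcases hz with hz | hz
  · left
    constructor <;> linarith
  · exact Or.inr hz

theorem one_sub_mem_cutPlane₀₁ {z : ℂ} (hz : z ∈ cutPlane₀₁) : 1 - z ∈ cutPlane₀₁ := by
  rw [mem_cutPlane₀₁_iff] at hz ⊢
  simp
  rcases hz with hz | hz
  · exact Or.inl ⟨hz.2, hz.1⟩
  · exact Or.inr hz

theorem sq_mem_polylogDomain {z : ℂ} (hz : z ∈ cutPlanePM) : z ^ 2 ∈ polylogDomain := by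
  rw [mem_cutPlanePM_iff] at hz
  rw [mem_polylogDomain_iff, sq, Complex.mul_re, Complex.mul_im]
  rcases eq_or_ne z.im 0 with h0 | h0
  · rw [h0] at hz
    left
    rcases hz with hz | hz
    · rw [h0]
      nlinarith
    · exact absurd rfl hz
  · rcases eq_or_ne z.re 0 with h1 | h1
    · left
      rw [h1]
      nlinarith [mul_self_nonneg z.im]
    · right
      intro h
      have : z.re * z.im = 0 := by linarith
      simp_all

theorem cayley_mem_slitPlane {z : ℂ} (hz : z ∈ cutPlanePM) :
    (1 - z) / (1 + z) ∈ Complex.slitPlane := by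
  have h1 := one_add_ne_zero_of_mem hz
  have hn : 0 < Complex.normSq (1 + z) := Complex.normSq_pos.2 h1
  rw [mem_cutPlanePM_iff] at hz
  rw [Complex.mem_slitPlane_iff, Complex.div_re, Complex.div_im]
  simp only [Complex.sub_re, Complex.add_re, Complex.one_re, Complex.sub_im, Complex.add_im,
    Complex.one_im]
  rcases eq_or_ne z.im 0 with h0 | h0
  · left
    have hz' : -1 < z.re ∧ z.re < 1 := hz.resolve_right (by simp [h0])
    rw [h0]
    have : 0 < (1 - z.re) * (1 + z.re) := mul_pos (by linarith) (by linarith)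
    have h2 : 0 < (1 - z.re) * (1 + z.re) / Complex.normSq (1 + z) := div_pos this hn
    simpa using h2
  · right
    rw [← sub_div]
    refine div_ne_zero ?_ hn.ne'
    intro h
    apply h0
    linarith

theorem cayley_mem_polylogDomain {z : ℂ} (hz : z ∈ cutPlane₀₁) :
    (1 - z) / (1 + z) ∈ polylogDomain := by
  have h0 : z ≠ 0 := Complex.slitPlane_ne_zero hz.2
  have h1 := one_add_ne_zero_of_mem (cutPlane₀₁_subset_cutPlanePM hz)
  have hn : 0 < Complex.normSq (1 + z) := Complex.normSq_pos.2 h1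
  have e : 1 - (1 - z) / (1 + z) = 2 * z / (1 + z) := by
    field_simp
    ring
  rw [mem_cutPlane₀₁_iff] at hz
  rw [polylogDomain, mem_ofPred_eq, e, Complex.mem_slitPlane_iff, Complex.div_re, Complex.div_im]
  simp only [Complex.add_re, Complex.one_re, Complex.add_im, Complex.mul_re, Complex.mul_im,
    Complex.one_im, Complex.re_ofNat, Complex.im_ofNat]
  rcases eq_or_ne z.im 0 with h0 | h0
  · left
    have hz' : 0 < z.re ∧ z.re < 1 := hz.resolve_right (by simp [h0])
    rw [h0]
    have : 0 < (2 * z.re) * (1 + z.re) := mul_pos (by linarith) (by linarith)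
    have h2 : 0 < (2 * z.re) * (1 + z.re) / Complex.normSq (1 + z) := div_pos this hn
    simpa using h2
  · right
    rw [← sub_div]
    refine div_ne_zero ?_ hn.ne'
    intro h
    apply h0
    linarith

theorem cayley_mem_cutPlane₀₁ {z : ℂ} (hz : z ∈ cutPlane₀₁) : (1 - z) / (1 + z) ∈ cutPlane₀₁ :=
  ⟨cayley_mem_polylogDomain hz, cayley_mem_slitPlane (cutPlane₀₁_subset_cutPlanePM hz)⟩

theorem one_sub_landen {z : ℂ} (hz : 1 - z ≠ 0) : 1 - z / (z - 1) = (1 - z)⁻¹ := by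
  have : z - 1 ≠ 0 := by
    intro h
    apply hz
    rw [← neg_sub, h, neg_zero]
  have h2 : z - 1 = -(1 - z) := by ring
  rw [h2]
  field_simp
  ring

theorem inv_mem_slitPlane {z : ℂ} (hz : z ∈ Complex.slitPlane) : z⁻¹ ∈ Complex.slitPlane := by
  rw [Complex.mem_slitPlane_iff_arg] at hz ⊢
  exact ⟨by rw [Complex.arg_inv, if_neg hz.1]; intro h; have := Complex.neg_pi_lt_arg z; linarith,
    inv_ne_zero hz.2⟩

theorem landen_mem_polylogDomain {z : ℂ} (hz : z ∈ polylogDomain) : z / (z - 1) ∈ polylogDomain := by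
  rw [polylogDomain, mem_ofPred_eq, one_sub_landen (one_sub_ne_zero_of_mem hz)]
  exact inv_mem_slitPlane hz

theorem log_inv_of_mem {z : ℂ} (hz : z ∈ Complex.slitPlane) : Complex.log z⁻¹ = -Complex.log z :=
  Complex.log_inv z (Complex.slitPlane_arg_ne_pi hz)

theorem log_one_sub_landen {z : ℂ} (hz : z ∈ polylogDomain) :
    Complex.log (1 - z / (z - 1)) = -Complex.log (1 - z) := by
  rw [one_sub_landen (one_sub_ne_zero_of_mem hz), log_inv_of_mem hz]

/-! ### Derivatives in logarithmic form -/

theorem hasDerivAt_log_comp {φ : ℂ → ℂ} {z ω : ℂ} (hφ : HasDerivAt φ (φ z * ω) z)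
    (h : φ z ∈ Complex.slitPlane) : HasDerivAt (fun z => Complex.log (φ z)) ω z := by
  refine (hφ.clog h).congr_deriv ?_
  rw [mul_div_cancel_left₀ _ (Complex.slitPlane_ne_zero h)]

/-- Writing the derivative of `φ` as `φ z * ω`, with `ω` its logarithmic derivative, cancels the
`1/φ z` of the integrand. Substitutions then only replace `ω`, and checking a derivative becomes
algebra in logarithms and simple fractions. -/
theorem hasDerivAt_divPrim_comp {g : ℂ → ℂ} (hg : DifferentiableOn ℂ g polylogDomain)
    (hg0 : g 0 = 0) {φ : ℂ → ℂ} {z ω : ℂ} (hφ : HasDerivAt φ (φ z * ω) z)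
    (h : φ z ∈ polylogDomain) (h0 : φ z ≠ 0) :
    HasDerivAt (fun z => divPrim g (φ z)) (g (φ z) * ω) z := by
  refine ((hasDerivAt_divPrim hg hg0 h h0).comp z hφ).congr_deriv ?_
  field_simp

theorem hasDerivAt_id_dlog {z : ℂ} (h0 : z ≠ 0) : HasDerivAt (fun z : ℂ => z) (z * z⁻¹) z :=
  (hasDerivAt_id z).congr_deriv (mul_inv_cancel₀ h0).symm

theorem hasDerivAt_neg_dlog {z : ℂ} (h0 : z ≠ 0) : HasDerivAt (fun z : ℂ => -z) (-z * z⁻¹) z :=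
  (hasDerivAt_id z).neg.congr_deriv (by field_simp)

/-- At `z = 0` the convention `0⁻¹ = 0` gives the correct derivative `0`. -/
theorem hasDerivAt_sq_dlog (z : ℂ) :
    HasDerivAt (fun z : ℂ => z ^ 2) (z ^ 2 * (2 * z⁻¹)) z :=
  ((hasDerivAt_id z).pow 2).congr_deriv (by field_simp; simp; ring)

theorem hasDerivAt_inv_dlog {z : ℂ} (h0 : z ≠ 0) :
    HasDerivAt (fun z : ℂ => z⁻¹) (z⁻¹ * -z⁻¹) z :=
  (hasDerivAt_inv h0).congr_deriv (by field_simp)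

theorem hasDerivAt_one_sub_dlog {z : ℂ} (h0 : 1 - z ≠ 0) :
    HasDerivAt (fun z : ℂ => 1 - z) ((1 - z) * -(1 - z)⁻¹) z :=
  ((hasDerivAt_id z).const_sub 1).congr_deriv (by field_simp)

theorem hasDerivAt_one_add_dlog {z : ℂ} (h0 : 1 + z ≠ 0) :
    HasDerivAt (fun z : ℂ => 1 + z) ((1 + z) * (1 + z)⁻¹) z :=
  ((hasDerivAt_id z).const_add 1).congr_deriv (by field_simp)

theorem hasDerivAt_landen_dlog {z : ℂ} (h0 : z ≠ 0) (h1 : 1 - z ≠ 0) :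
    HasDerivAt (fun z : ℂ => z / (z - 1)) (z / (z - 1) * (z⁻¹ + (1 - z)⁻¹)) z := by
  have h2 : z - 1 ≠ 0 := by
    intro h
    apply h1
    rw [← neg_sub, h, neg_zero]
  have h3 : 1 - z = -(z - 1) := by ring
  refine ((hasDerivAt_id z).div ((hasDerivAt_id z).sub_const 1) h2).congr_deriv ?_
  rw [h3]
  simp only [id]
  field_simp
  ring

theorem hasDerivAt_cayley_dlog {z : ℂ} (h1 : 1 - z ≠ 0) (h2 : 1 + z ≠ 0) :
    HasDerivAt (fun z : ℂ => (1 - z) / (1 + z))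
      ((1 - z) / (1 + z) * -((1 - z)⁻¹ + (1 + z)⁻¹)) z := by
  refine (((hasDerivAt_id z).const_sub 1).div ((hasDerivAt_id z).const_add 1) h2).congr_deriv ?_
  simp only [id]
  field_simp
  ring

theorem HasDerivAt.neg_dlog {φ : ℂ → ℂ} {z ω : ℂ} (h : HasDerivAt φ (φ z * ω) z) :
    HasDerivAt (fun z => -φ z) (-φ z * ω) z :=
  h.neg.congr_deriv (by ring)

theorem HasDerivAt.sq_dlog {φ : ℂ → ℂ} {z ω : ℂ} (h : HasDerivAt φ (φ z * ω) z) :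
    HasDerivAt (fun z => φ z ^ 2) (φ z ^ 2 * (2 * ω)) z :=
  (h.pow 2).congr_deriv (by simp; ring)

/-! ### Logarithms of Möbius transforms -/

/-- No multiple of `2πi` can appear: both sides are holomorphic on a connected domain, have the same
derivative and agree at `0`. -/
theorem log_cayley {z : ℂ} (hz : z ∈ cutPlanePM) :
    Complex.log ((1 - z) / (1 + z)) = Complex.log (1 - z) - Complex.log (1 + z) := by
  have hd : ∀ z ∈ cutPlanePM, HasDerivAt (fun z => Complex.log ((1 - z) / (1 + z))
      - (Complex.log (1 - z) - Complex.log (1 + z))) 0 z := fun z hz => by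
    have h1 := one_sub_ne_zero_of_mem hz.1
    have h2 := one_add_ne_zero_of_mem hz
    refine ((hasDerivAt_log_comp (hasDerivAt_cayley_dlog h1 h2) (cayley_mem_slitPlane hz)).sub
      ((hasDerivAt_log_comp (hasDerivAt_one_sub_dlog h1) hz.1).sub
      (hasDerivAt_log_comp (hasDerivAt_one_add_dlog h2) (one_add_mem_slitPlane hz)))).congr_deriv ?_
    ring
  have := eq_of_hasDerivAt_zero isOpen_cutPlanePM isPreconnected_cutPlanePM
    (fun z hz => (hd z hz).differentiableAt.differentiableWithinAt) (fun z hz _ => hd z hz) hz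
    zero_mem_cutPlanePM
  simp at this
  linear_combination this

theorem log_one_sub_sq {z : ℂ} (hz : z ∈ cutPlanePM) :
    Complex.log (1 - z ^ 2) = Complex.log (1 - z) + Complex.log (1 + z) := by
  have hd : ∀ z ∈ cutPlanePM, HasDerivAt (fun z => Complex.log (1 - z ^ 2)
      - (Complex.log (1 - z) + Complex.log (1 + z))) 0 z := fun z hz => by
    have h1 := one_sub_ne_zero_of_mem hz.1
    have h2 := one_add_ne_zero_of_mem hz
    have h3 : HasDerivAt (fun z : ℂ => 1 - z ^ 2) ((1 - z ^ 2) * (-(1 - z)⁻¹ + (1 + z)⁻¹)) z := by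
      refine (((hasDerivAt_id z).pow 2).const_sub 1).congr_deriv ?_
      simp only [id]
      field_simp
      norm_num
      ring
    refine ((hasDerivAt_log_comp h3 (sq_mem_polylogDomain hz)).sub
      ((hasDerivAt_log_comp (hasDerivAt_one_sub_dlog h1) hz.1).add
      (hasDerivAt_log_comp (hasDerivAt_one_add_dlog h2) (one_add_mem_slitPlane hz)))).congr_deriv ?_
    ring
  have := eq_of_hasDerivAt_zero isOpen_cutPlanePM isPreconnected_cutPlanePM
    (fun z hz => (hd z hz).differentiableAt.differentiableWithinAt) (fun z hz _ => hd z hz) hz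
    zero_mem_cutPlanePM
  simp at this
  linear_combination this

theorem log_two_mul {z : ℂ} (hz : z ≠ 0) :
    Complex.log (2 * z) = (Real.log 2 : ℂ) + Complex.log z := by
  have := Complex.log_ofReal_mul two_pos hz
  simpa using this

theorem log_one_add_cayley {z : ℂ} (hz : z ∈ cutPlanePM) :
    Complex.log (1 + (1 - z) / (1 + z)) = (Real.log 2 : ℂ) - Complex.log (1 + z) := by
  have h2 := one_add_ne_zero_of_mem hz
  have e : 1 + (1 - z) / (1 + z) = 2 * (1 + z)⁻¹ := by
    field_simp
    ring
  rw [e, log_two_mul (inv_ne_zero h2), log_inv_of_mem (one_add_mem_slitPlane hz), sub_eq_add_neg]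

theorem one_add_inv_mem_slitPlane {z : ℂ} (hz : z ∈ Complex.slitPlane) :
    1 + z⁻¹ ∈ Complex.slitPlane := by
  have := inv_mem_slitPlane hz
  rw [Complex.mem_slitPlane_iff] at this ⊢
  simp only [Complex.add_re, Complex.one_re, Complex.add_im, Complex.one_im, zero_add]
  rcases this with h | h
  · left; linarith
  · exact Or.inr h

/-- Same comparison of derivatives, now normalised at `z = 1`. -/
theorem log_one_add_inv {z : ℂ} (hz : z ∈ Complex.slitPlane) :
    Complex.log (1 + z⁻¹) = Complex.log (1 + z) - Complex.log z := by
  have key : ∀ z ∈ Complex.slitPlane, 1 + z ∈ Complex.slitPlane := fun z hz => by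
    simpa using one_add_inv_mem_slitPlane (inv_mem_slitPlane hz)
  have hd : ∀ z ∈ Complex.slitPlane, HasDerivAt (fun z => Complex.log (1 + z⁻¹)
      - (Complex.log (1 + z) - Complex.log z)) 0 z := fun z hz => by
    have h0 := Complex.slitPlane_ne_zero hz
    have h2 := Complex.slitPlane_ne_zero (key z hz)
    have h3 : HasDerivAt (fun z : ℂ => 1 + z⁻¹) ((1 + z⁻¹) * ((1 + z)⁻¹ - z⁻¹)) z := by
      refine ((hasDerivAt_inv h0).const_add 1).congr_deriv ?_
      field_simp
      ring
    refine ((hasDerivAt_log_comp h3 (one_add_inv_mem_slitPlane hz)).sub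
      ((hasDerivAt_log_comp (hasDerivAt_one_add_dlog h2) (key z hz)).sub
      (hasDerivAt_log_comp (hasDerivAt_id_dlog h0) hz))).congr_deriv ?_
    ring
  have h1s : (1 : ℂ) ∈ Complex.slitPlane := Complex.one_mem_slitPlane
  have hpc : IsPreconnected Complex.slitPlane :=
    (Complex.starConvex_one_slitPlane.isPathConnected h1s).isConnected.isPreconnected
  have h := eq_of_hasDerivAt_zero Complex.isOpen_slitPlane hpc
    (fun z hz => (hd z hz).differentiableAt.differentiableWithinAt) (fun z hz _ => hd z hz) hz h1s
  simp at h
  linear_combination h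

theorem log_one_sub_cayley {z : ℂ} (hz : z ∈ cutPlane₀₁) :
    Complex.log (1 - (1 - z) / (1 + z))
      = (Real.log 2 : ℂ) + Complex.log z - Complex.log (1 + z) := by
  have h0 := Complex.slitPlane_ne_zero hz.2
  have h2 := one_add_ne_zero_of_mem (cutPlane₀₁_subset_cutPlanePM hz)
  have h3 := one_add_inv_mem_slitPlane hz.2
  have e : 1 - (1 - z) / (1 + z) = 2 * (1 + z⁻¹)⁻¹ := by
    have e2 : 1 + z⁻¹ = (1 + z) / z := by
      field_simp
      ring
    rw [e2]
    field_simp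
    ring
  rw [e, log_two_mul (inv_ne_zero (Complex.slitPlane_ne_zero h3)), log_inv_of_mem h3,
    log_one_add_inv hz.2]
  ring

theorem log_neg_of_im_pos {z : ℂ} (hz : 0 < z.im) :
    Complex.log (-z) = Complex.log z - Real.pi * Complex.I := by
  rw [Complex.log, Complex.log, norm_neg, Complex.arg_neg_eq_arg_sub_pi_of_im_pos hz]
  push_cast
  ring

/-! ### Limits at the origin -/

theorem tendsto_self_mul_log_pow (k : ℕ) :
    Filter.Tendsto (fun z : ℂ => z * Complex.log z ^ (k + 1)) (nhds 0) (nhds 0) := by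
  have hc : ContinuousAt (fun z : ℂ => z * Complex.log z ^ (k + 1)) 0 := by
    rw [continuousAt_iff_punctured_nhds, zero_mul]
    have hr : (0 : ℝ) < ((k + 1 : ℕ) : ℝ)⁻¹ := by positivity
    have hn : Filter.Tendsto (fun z : ℂ => ‖z‖) (nhdsWithin 0 {0}ᶜ) (nhdsWithin 0 (Ioi 0)) :=
      tendsto_norm_nhdsNE_zero
    have h1 := (tendsto_log_mul_rpow_nhdsGT_zero hr).comp hn
    have h2 : Filter.Tendsto (fun x : ℝ => x ^ ((k + 1 : ℕ) : ℝ)⁻¹) (nhdsWithin 0 (Ioi 0)) (nhds 0) := by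
      have := (Real.continuousAt_rpow_const 0 _ (Or.inr hr.le)).tendsto.mono_left
        (nhdsWithin_le_nhds (s := Ioi (0 : ℝ)))
      rwa [Real.zero_rpow hr.ne'] at this
    have h3 := ((h1.abs.add ((h2.comp hn).mul_const Real.pi)).pow (k + 1))
    simp only [abs_zero, zero_mul, add_zero, ne_eq, Nat.add_eq_zero_iff, one_ne_zero, and_false,
      not_false_eq_true, zero_pow] at h3
    refine squeeze_zero_norm' ?_ h3
    filter_upwards [self_mem_nhdsWithin] with z hz
    have hz0 : 0 < ‖z‖ := norm_pos_iff.2 hz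
    -- One `(k+1)`-th root of `‖z‖` is given to each factor `log z`, reducing the claim to the decay
    -- of `x ^ r * log x` with `r > 0`; the argument contributes at most `π`.
    have e : ‖z‖ = (‖z‖ ^ ((k + 1 : ℕ) : ℝ)⁻¹) ^ (k + 1) :=
      (Real.rpow_inv_natCast_pow (norm_nonneg z) (Nat.succ_ne_zero k)).symm
    rw [norm_mul, norm_pow]
    nth_rewrite 1 [e]
    rw [← mul_pow]
    refine pow_le_pow_left₀ (by positivity) ?_ _
    simp only [Function.comp_apply]
    rw [abs_mul, abs_of_nonneg (by positivity : 0 ≤ ‖z‖ ^ ((k + 1 : ℕ) : ℝ)⁻¹), mul_comm |_|,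
      ← mul_add]
    refine mul_le_mul_of_nonneg_left ?_ (by positivity)
    rw [Complex.log]
    refine (norm_add_le _ _).trans (add_le_add ?_ ?_)
    · rw [Complex.norm_real, Real.norm_eq_abs]
    · rw [norm_mul, Complex.norm_I, mul_one, Complex.norm_real, Real.norm_eq_abs]
      exact Complex.abs_arg_le_pi z
  simpa using hc.tendsto

/-- A zero of `f` at the origin supplies a factor `z`, which absorbs any power of the logarithm. -/
theorem tendsto_log_pow_mul (k : ℕ) {f : ℂ → ℂ} (hf : DifferentiableAt ℂ f 0) (h0 : f 0 = 0) :
    Filter.Tendsto (fun z : ℂ => Complex.log z ^ (k + 1) * f z) (nhds 0) (nhds 0) := by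
  have h1 : Filter.Tendsto (dslope f 0) (nhds 0) (nhds (dslope f 0 0)) :=
    (continuousAt_dslope_same.2 hf).tendsto
  have h2 := (tendsto_self_mul_log_pow k).mul h1
  rw [zero_mul] at h2
  refine h2.congr fun z => ?_
  have h3 := sub_smul_dslope f 0 z
  rw [sub_zero, h0, sub_zero, smul_eq_mul] at h3
  rw [← h3]
  ring

theorem tendsto_log_mul {f : ℂ → ℂ} (hf : DifferentiableAt ℂ f 0) (h0 : f 0 = 0) :
    Filter.Tendsto (fun z : ℂ => Complex.log z * f z) (nhds 0) (nhds 0) := by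
  simpa using tendsto_log_pow_mul 0 hf h0

/-! ### The polylogarithms as iterated primitives -/

theorem differentiableOn_log_one_sub :
    DifferentiableOn ℂ (fun z => Complex.log (1 - z)) polylogDomain := fun _ hz =>
  (hasDerivAt_log_comp (hasDerivAt_one_sub_dlog (one_sub_ne_zero_of_mem hz))
    hz).differentiableAt.differentiableWithinAt

theorem polylog_zero_right (n : ℕ) : polylog n 0 = 0 := by
  have := (isPolylog_polylog n).hasSum 0 (by simp)
  simpa using this.unique (by simp)

theorem differentiableOn_polylog (n : ℕ) : DifferentiableOn ℂ (polylog n) polylogDomain :=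
  (isPolylog_polylog n).differentiableOn

theorem polylog_one {z : ℂ} (hz : z ∈ polylogDomain) : polylog 1 z = -Complex.log (1 - z) := by
  refine (isPolylog_polylog 1).eqOn (g := fun z => -Complex.log (1 - z))
    ⟨differentiableOn_log_one_sub.neg, fun z hz => ?_⟩ hz
  simpa using Complex.hasSum_taylorSeries_neg_log' hz

theorem polylog_succ (n : ℕ) : EqOn (polylog (n + 1)) (divPrim (polylog n)) polylogDomain :=
  (isPolylog_polylog (n + 1)).eqOn (isPolylog_divPrim (isPolylog_polylog n))

theorem hasDerivAt_polylog_comp (n : ℕ) {φ : ℂ → ℂ} {z ω : ℂ} (hφ : HasDerivAt φ (φ z * ω) z)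
    (h : φ z ∈ polylogDomain) (h0 : φ z ≠ 0) :
    HasDerivAt (fun z => polylog (n + 1) (φ z)) (polylog n (φ z) * ω) z := by
  refine (hasDerivAt_divPrim_comp (differentiableOn_polylog n) (polylog_zero_right n) hφ h
    h0).congr_of_eventuallyEq ?_
  filter_upwards [hφ.continuousAt.preimage_mem_nhds (isOpen_polylogDomain.mem_nhds h)] with w hw
  exact polylog_succ n hw

theorem log_one_sub_conj {z : ℂ} (hz : z ∈ polylogDomain) :
    Complex.log (1 - (starRingEnd ℂ) z) = (starRingEnd ℂ) (Complex.log (1 - z)) := by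
  rw [← Complex.log_conj _ (Complex.slitPlane_arg_ne_pi hz)]
  simp

theorem polylog_conj (n : ℕ) {z : ℂ} (hz : z ∈ polylogDomain) :
    polylog (n + 1) ((starRingEnd ℂ) z) = (starRingEnd ℂ) (polylog (n + 1) z) := by
  induction n generalizing z with
  | zero => rw [polylog_one hz, polylog_one (conj_mem_polylogDomain hz), log_one_sub_conj hz, map_neg]
  | succ n ih =>
    rw [polylog_succ _ hz, polylog_succ _ (conj_mem_polylogDomain hz)]
    exact divPrim_conj (differentiableOn_polylog _) (polylog_zero_right _) (fun z hz => ih hz) hz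

/-! ### Boundary values at `1` and zeta values -/

theorem norm_natCast_add_one (k : ℕ) : ‖(k : ℂ) + 1‖ = (k : ℝ) + 1 := by
  exact_mod_cast Complex.norm_natCast (k + 1)

theorem riemannZeta_nat_eq_tsum (n : ℕ) (hn : 2 ≤ n) :
    riemannZeta n = ∑' k : ℕ, 1 / ((k : ℂ) + 1) ^ n := by
  have := zeta_eq_tsum_one_div_nat_add_one_cpow (s := (n : ℂ)) (by simp; omega)
  rw [this]
  simp

theorem summable_one_div_add_one_pow (n : ℕ) (hn : 2 ≤ n) :
    Summable fun k : ℕ => 1 / ((k : ℝ) + 1) ^ n := by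
  have := (summable_nat_add_iff 1).2 (Real.summable_one_div_nat_pow.2 (show 1 < n by omega))
  simpa using this

/-- For `n ≥ 2` the series on `(0, 1)` is dominated by its convergent value at `1`. -/
theorem tendsto_polylog_one (n : ℕ) (hn : 2 ≤ n) :
    Filter.Tendsto (fun x : ℝ => polylog n x) (nhdsWithin 1 (Iio 1)) (nhds (riemannZeta n)) := by
  rw [riemannZeta_nat_eq_tsum n hn]
  have hev : ∀ᶠ x : ℝ in nhdsWithin 1 (Iio 1), 0 < x ∧ x < 1 := by
    filter_upwards [nhdsWithin_le_nhds (lt_mem_nhds zero_lt_one), self_mem_nhdsWithin] with x h h'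
    exact ⟨h, h'⟩
  have h : Filter.Tendsto (fun x : ℝ => ∑' k : ℕ, (x : ℂ) ^ (k + 1) / ((k : ℂ) + 1) ^ n)
      (nhdsWithin 1 (Iio 1)) (nhds (∑' k : ℕ, 1 / ((k : ℂ) + 1) ^ n)) := by
    refine tendsto_tsum_of_dominated_convergence (summable_one_div_add_one_pow n hn) (fun k => ?_) ?_
    · have : Continuous fun x : ℝ => (x : ℂ) ^ (k + 1) / ((k : ℂ) + 1) ^ n := by fun_prop
      simpa using (this.tendsto 1).mono_left nhdsWithin_le_nhds
    · filter_upwards [hev] with x hx k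
      rw [norm_div, norm_pow, norm_pow, norm_natCast_add_one, Complex.norm_real, Real.norm_eq_abs,
        abs_of_pos hx.1]
      gcongr
      exact pow_le_one₀ hx.1.le hx.2.le
  refine h.congr' ?_
  filter_upwards [hev] with x hx
  refine ((isPolylog_polylog n).hasSum x ?_).tsum_eq
  rw [Complex.norm_real, Real.norm_eq_abs, abs_of_pos hx.1]
  exact hx.2

/-! ### Iterated primitives of powers of `log (1 - z)` -/

/-- `∫_0^z log (1 - s) ^ 2 / s ds` -/
noncomputable def logSqPrim : ℂ → ℂ := divPrim fun z => Complex.log (1 - z) ^ 2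

/-- `∫_0^z log (1 - s) ^ 3 / s ds` -/
noncomputable def logCubePrim : ℂ → ℂ := divPrim fun z => Complex.log (1 - z) ^ 3

/-- The iterated primitive `∫_0^z logSqPrim s / s ds`. -/
noncomputable def logSqPrim₂ : ℂ → ℂ := divPrim logSqPrim

theorem differentiableOn_logSqPrim : DifferentiableOn ℂ logSqPrim polylogDomain :=
  differentiableOn_divPrim (differentiableOn_log_one_sub.pow 2)

theorem differentiableOn_logCubePrim : DifferentiableOn ℂ logCubePrim polylogDomain :=
  differentiableOn_divPrim (differentiableOn_log_one_sub.pow 3)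

theorem differentiableOn_logSqPrim₂ : DifferentiableOn ℂ logSqPrim₂ polylogDomain :=
  differentiableOn_divPrim differentiableOn_logSqPrim

@[simp] theorem logSqPrim_zero : logSqPrim 0 = 0 := divPrim_zero _
@[simp] theorem logCubePrim_zero : logCubePrim 0 = 0 := divPrim_zero _
@[simp] theorem logSqPrim₂_zero : logSqPrim₂ 0 = 0 := divPrim_zero _

section comp

variable {φ : ℂ → ℂ} {z ω : ℂ}

theorem hasDerivAt_logSqPrim_comp (hφ : HasDerivAt φ (φ z * ω) z) (h : φ z ∈ polylogDomain)
    (h0 : φ z ≠ 0) :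
    HasDerivAt (fun z => logSqPrim (φ z)) (Complex.log (1 - φ z) ^ 2 * ω) z :=
  hasDerivAt_divPrim_comp (differentiableOn_log_one_sub.pow 2) (by simp) hφ h h0

theorem hasDerivAt_logCubePrim_comp (hφ : HasDerivAt φ (φ z * ω) z) (h : φ z ∈ polylogDomain)
    (h0 : φ z ≠ 0) :
    HasDerivAt (fun z => logCubePrim (φ z)) (Complex.log (1 - φ z) ^ 3 * ω) z :=
  hasDerivAt_divPrim_comp (differentiableOn_log_one_sub.pow 3) (by simp) hφ h h0

theorem hasDerivAt_logSqPrim₂_comp (hφ : HasDerivAt φ (φ z * ω) z) (h : φ z ∈ polylogDomain)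
    (h0 : φ z ≠ 0) :
    HasDerivAt (fun z => logSqPrim₂ (φ z)) (logSqPrim (φ z) * ω) z :=
  hasDerivAt_divPrim_comp differentiableOn_logSqPrim logSqPrim_zero hφ h h0

end comp

/-! ### The double series for `logSqPrim₂` and its value at `1` -/

theorem HasSum.sq_of_summable_norm {f : ℕ → ℂ} {s : ℂ} (h : HasSum f s)
    (hn : Summable fun k : ℕ => ‖f k‖) : HasSum (fun i : ℕ × ℕ => f i.1 * f i.2) (s ^ 2) := by
  have h2 := HasSum.mul h h (summable_mul_of_summable_norm hn hn)
  rw [sq]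
  exact h2

theorem hasSum_log_one_sub_sq {z : ℂ} (hz : ‖z‖ < 1) :
    HasSum (fun i : ℕ × ℕ => 1 / (((i.1 : ℂ) + 1) * ((i.2 : ℂ) + 1)) * z ^ (i.1 + i.2 + 1 + 1))
      (Complex.log (1 - z) ^ 2) := by
  have h := Complex.hasSum_taylorSeries_neg_log' hz
  have hn : Summable fun k : ℕ => ‖z ^ (k + 1) / ((k : ℂ) + 1)‖ := by
    refine Summable.of_nonneg_of_le (fun k => norm_nonneg _) (fun k => ?_)
      (summable_geometric_of_lt_one (norm_nonneg z) hz)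
    rw [norm_div, norm_pow, norm_natCast_add_one, pow_succ]
    refine (div_le_self (by positivity) (by
      have := Nat.cast_nonneg (α := ℝ) k
      linarith)).trans ?_
    exact mul_le_of_le_one_right (by positivity) hz.le
  have h2 := h.sq_of_summable_norm hn
  rw [neg_sq] at h2
  have h3 : ∀ i : ℕ × ℕ, 1 / (((i.1 : ℂ) + 1) * ((i.2 : ℂ) + 1)) * z ^ (i.1 + i.2 + 1 + 1)
      = z ^ (i.1 + 1) / ((i.1 : ℂ) + 1) * (z ^ (i.2 + 1) / ((i.2 : ℂ) + 1)) := fun i => by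
    rw [div_mul_div_comm, ← pow_add, div_mul_eq_mul_div, one_mul, add_add_add_comm, add_assoc]
  rw [funext h3]
  exact h2

theorem norm_one_div_natCast_add_one_mul (i : ℕ × ℕ) :
    ‖1 / (((i.1 : ℂ) + 1) * ((i.2 : ℂ) + 1))‖ = 1 / (((i.1 : ℝ) + 1) * ((i.2 : ℝ) + 1)) := by
  rw [norm_div, norm_mul, norm_natCast_add_one, norm_natCast_add_one, norm_one]

theorem summable_pow_add {r : ℝ} (hr : 0 ≤ r) (hr1 : r < 1) :
    Summable fun i : ℕ × ℕ => r ^ (i.1 + i.2 + 1) := by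
  have h := summable_geometric_of_lt_one hr hr1
  have := (h.mul_of_nonneg h (fun _ => by positivity) (fun _ => by positivity)).mul_right r
  refine this.congr fun i => ?_
  ring

theorem hasSum_logSqPrim₂ {z : ℂ} (hz : ‖z‖ < 1) :
    HasSum (fun i : ℕ × ℕ => 1 / (((i.1 : ℂ) + 1) * ((i.2 : ℂ) + 1) * ((i.1 : ℂ) + i.2 + 2) ^ 2)
      * z ^ (i.1 + i.2 + 1 + 1)) (logSqPrim₂ z) := by
  have hle : ∀ i : ℕ × ℕ, ‖1 / (((i.1 : ℂ) + 1) * ((i.2 : ℂ) + 1))‖ ≤ 1 := fun i => by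
    rw [norm_one_div_natCast_add_one_mul]
    refine div_le_one_of_le₀ ?_ (by positivity)
    have h1 := Nat.cast_nonneg (α := ℝ) i.1
    have h2 := Nat.cast_nonneg (α := ℝ) i.2
    nlinarith [mul_nonneg h1 h2]
  have hs1 : ∀ r : ℝ, 0 ≤ r → r < 1 → Summable fun i : ℕ × ℕ =>
      ‖1 / (((i.1 : ℂ) + 1) * ((i.2 : ℂ) + 1))‖ * r ^ (i.1 + i.2 + 1) := fun r hr hr1 =>
    Summable.of_nonneg_of_le (fun i => by positivity)
      (fun i => mul_le_of_le_one_left (by positivity) (hle i)) (summable_pow_add hr hr1)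
  have hne : ∀ i : ℕ × ℕ, 1 ≤ ‖((i.1 + i.2 + 1 : ℕ) : ℂ) + 1‖ := fun i => by
    rw [norm_natCast_add_one]
    have := Nat.cast_nonneg (α := ℝ) (i.1 + i.2 + 1)
    linarith
  have h1 : ∀ z : ℂ, ‖z‖ < 1 → HasSum _ (logSqPrim z) := fun z hz =>
    hasSum_divPrim (g := fun z => Complex.log (1 - z) ^ 2)
      (c := fun i : ℕ × ℕ => 1 / (((i.1 : ℂ) + 1) * ((i.2 : ℂ) + 1)))
      (e := fun i : ℕ × ℕ => i.1 + i.2 + 1) (by simp) hs1 (fun z hz => hasSum_log_one_sub_sq hz) hz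
  have h2 := hasSum_divPrim (g := logSqPrim) logSqPrim_zero (fun r hr hr1 => ?_) h1 hz
  · refine h2.congr_fun fun i => ?_
    have h3 : (i.1 : ℂ) + 1 ≠ 0 := Nat.cast_add_one_ne_zero _
    have h4 : (i.2 : ℂ) + 1 ≠ 0 := Nat.cast_add_one_ne_zero _
    have h5 : (i.1 : ℂ) + i.2 + 2 ≠ 0 := by
      have := Nat.cast_add_one_ne_zero (R := ℂ) (i.1 + i.2 + 1)
      push_cast at this
      rwa [add_assoc, one_add_one_eq_two] at this
    have h6 : (((i.1 + i.2 + 1 : ℕ) : ℂ) + 1) = (i.1 : ℂ) + i.2 + 2 := by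
      push_cast
      ring
    rw [h6]
    field_simp
  · refine Summable.of_nonneg_of_le (fun i => by positivity) (fun i => ?_) (hs1 r hr hr1)
    rw [norm_div]
    gcongr
    exact div_le_self (norm_nonneg _) (hne i)

theorem summable_one_div_add_one_sq_mul :
    Summable fun i : ℕ × ℕ => 1 / (((i.1 : ℝ) + 1) ^ 2 * ((i.2 : ℝ) + 1) ^ 2) := by
  have h := summable_one_div_add_one_pow 2 le_rfl
  refine (h.mul_of_nonneg h (fun _ => by positivity) (fun _ => by positivity)).congr fun i => ?_
  rw [div_mul_div_comm, one_mul]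

/-- The square of `∑ 1/k²` is split into the diagonal, which gives the fourth powers, and two
off-diagonal halves equal by symmetry. The half above the diagonal is parametrised by its first
index and the gap. -/
theorem tsum_one_div_add_one_sq_mul_add_sq :
    2 * ∑' i : ℕ × ℕ, 1 / (((i.1 : ℝ) + 1) ^ 2 * ((i.1 : ℝ) + i.2 + 2) ^ 2)
      = (∑' k : ℕ, 1 / ((k : ℝ) + 1) ^ 2) ^ 2 - ∑' k : ℕ, 1 / ((k : ℝ) + 1) ^ 4 := by
  set f : ℕ × ℕ → ℝ := fun i => 1 / (((i.1 : ℝ) + 1) ^ 2 * ((i.2 : ℝ) + 1) ^ 2) with hf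
  have hfs : Summable f := summable_one_div_add_one_sq_mul
  have h := summable_one_div_add_one_pow 2 le_rfl
  have h1 : ∑' i, f i = (∑' k : ℕ, 1 / ((k : ℝ) + 1) ^ 2) ^ 2 := by
    rw [sq, h.tsum_mul_tsum h (h.mul_of_nonneg h (fun _ => by positivity) (fun _ => by positivity))]
    exact tsum_congr fun i => by rw [hf, div_mul_div_comm, one_mul]
  have hsplit : ∑' i, f i = ∑' i, {i : ℕ × ℕ | i.1 < i.2}.indicator f i
      + ∑' i, {i : ℕ × ℕ | i.1 = i.2}.indicator f i
      + ∑' i, {i : ℕ × ℕ | i.2 < i.1}.indicator f i := by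
    rw [← (hfs.indicator _).tsum_add (hfs.indicator _),
      ← ((hfs.indicator _).add (hfs.indicator _)).tsum_add (hfs.indicator _)]
    refine tsum_congr fun i => ?_
    rcases lt_trichotomy i.1 i.2 with h | h | h
    · simp [indicator, h, h.ne, h.not_gt]
    · simp [indicator, h]
    · simp [indicator, h, h.ne', h.not_gt]
  have hlt : ∑' i, {i : ℕ × ℕ | i.1 < i.2}.indicator f i
      = ∑' i : ℕ × ℕ, 1 / (((i.1 : ℝ) + 1) ^ 2 * ((i.1 : ℝ) + i.2 + 2) ^ 2) := by
    have hinj : Function.Injective fun i : ℕ × ℕ => (i.1, i.1 + i.2 + 1) := by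
      intro i j hij
      simp only [Prod.mk.injEq] at hij
      ext <;> omega
    rw [← hinj.tsum_eq]
    · refine tsum_congr fun i => ?_
      rw [indicator_of_mem (by simp only [mem_ofPred_eq]; omega), hf]
      push_cast
      ring_nf
    · intro i hi
      have : i.1 < i.2 := by
        by_contra h
        exact hi (indicator_of_notMem (s := {i : ℕ × ℕ | i.1 < i.2}) h f)
      exact ⟨(i.1, i.2 - i.1 - 1), by ext <;> simp; omega⟩
  have hgt : ∑' i, {i : ℕ × ℕ | i.2 < i.1}.indicator f i
      = ∑' i, {i : ℕ × ℕ | i.1 < i.2}.indicator f i := by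
    rw [← (Equiv.prodComm ℕ ℕ).tsum_eq]
    refine tsum_congr fun i => ?_
    simp only [indicator, hf, Equiv.prodComm_apply, Prod.fst_swap, Prod.snd_swap, mem_ofPred_eq]
    rw [mul_comm]
  have heq : ∑' i, {i : ℕ × ℕ | i.1 = i.2}.indicator f i = ∑' k : ℕ, 1 / ((k : ℝ) + 1) ^ 4 := by
    have hinj : Function.Injective fun i : ℕ => (i, i) := fun i j hij => (Prod.mk.inj hij).1
    rw [← hinj.tsum_eq]
    · refine tsum_congr fun i => ?_
      rw [indicator_of_mem (by simp), hf]
      ring_nf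
    · intro i hi
      have : i.1 = i.2 := by
        by_contra h
        exact hi (indicator_of_notMem (s := {i : ℕ × ℕ | i.1 = i.2}) h f)
      exact ⟨i.1, by ext <;> simp [this]⟩
  rw [← h1, hsplit, hgt, heq, hlt]
  ring

theorem summable_one_div_mul_add_sq :
    Summable fun i : ℕ × ℕ => 1 / (((i.1 : ℝ) + 1) * ((i.2 : ℝ) + 1) * ((i.1 : ℝ) + i.2 + 2) ^ 2) := by
  refine Summable.of_nonneg_of_le (fun i => by positivity) (fun i => ?_)
    summable_one_div_add_one_sq_mul
  refine one_div_le_one_div_of_le (by positivity) ?_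
  rw [show ((i.1 : ℝ) + 1) ^ 2 * ((i.2 : ℝ) + 1) ^ 2
    = ((i.1 : ℝ) + 1) * ((i.2 : ℝ) + 1) * (((i.1 : ℝ) + 1) * ((i.2 : ℝ) + 1)) by ring]
  refine mul_le_mul_of_nonneg_left ?_ (by positivity)
  have h1 := Nat.cast_nonneg (α := ℝ) i.1
  have h2 := Nat.cast_nonneg (α := ℝ) i.2
  nlinarith [mul_nonneg h1 h2]

/-- `(∑ 1/k²)²` is computed twice, by partial fractions and by the diagonal splitting; the sums with
two squared factors cancel. -/
theorem tsum_one_div_mul_add_sq :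
    ∑' i : ℕ × ℕ, 1 / (((i.1 : ℝ) + 1) * ((i.2 : ℝ) + 1) * ((i.1 : ℝ) + i.2 + 2) ^ 2)
      = (∑' k : ℕ, 1 / ((k : ℝ) + 1) ^ 4) / 2 := by
  have h := summable_one_div_add_one_pow 2 le_rfl
  have h1 : ∑' i : ℕ × ℕ, 1 / (((i.1 : ℝ) + 1) ^ 2 * ((i.2 : ℝ) + 1) ^ 2)
      = (∑' k : ℕ, 1 / ((k : ℝ) + 1) ^ 2) ^ 2 := by
    rw [sq, h.tsum_mul_tsum h (h.mul_of_nonneg h (fun _ => by positivity) (fun _ => by positivity))]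
    exact tsum_congr fun i => by rw [div_mul_div_comm, one_mul]
  have hs : Summable fun i : ℕ × ℕ => 1 / (((i.1 : ℝ) + 1) ^ 2 * ((i.1 : ℝ) + i.2 + 2) ^ 2) := by
    refine Summable.of_nonneg_of_le (fun i => by positivity) (fun i => ?_)
      summable_one_div_add_one_sq_mul
    have h1 := Nat.cast_nonneg (α := ℝ) i.1
    have h2 : (i.2 : ℝ) + 1 ≤ (i.1 : ℝ) + i.2 + 2 := by linarith
    gcongr
  have hs' : Summable fun i : ℕ × ℕ => 1 / (((i.2 : ℝ) + 1) ^ 2 * ((i.1 : ℝ) + i.2 + 2) ^ 2) := by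
    refine ((Equiv.prodComm ℕ ℕ).summable_iff.2 hs).congr fun i => ?_
    simp only [Function.comp_apply, Equiv.prodComm_apply, Prod.fst_swap, Prod.snd_swap]
    rw [add_comm (i.2 : ℝ) i.1]
  have hswap : ∑' i : ℕ × ℕ, 1 / (((i.2 : ℝ) + 1) ^ 2 * ((i.1 : ℝ) + i.2 + 2) ^ 2)
      = ∑' i : ℕ × ℕ, 1 / (((i.1 : ℝ) + 1) ^ 2 * ((i.1 : ℝ) + i.2 + 2) ^ 2) := by
    rw [← (Equiv.prodComm ℕ ℕ).tsum_eq]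
    refine tsum_congr fun i => ?_
    simp only [Equiv.prodComm_apply, Prod.fst_swap, Prod.snd_swap]
    rw [add_comm (i.2 : ℝ) i.1]
  -- With `a = i.1 + 1` and `b = i.2 + 1`, this is `(a+b)² = a² + b² + 2ab` divided by `a²b²(a+b)²`.
  have h2 : ∑' i : ℕ × ℕ, 1 / (((i.1 : ℝ) + 1) ^ 2 * ((i.2 : ℝ) + 1) ^ 2)
      = ∑' i : ℕ × ℕ, 1 / (((i.1 : ℝ) + 1) ^ 2 * ((i.1 : ℝ) + i.2 + 2) ^ 2)
        + ∑' i : ℕ × ℕ, 1 / (((i.2 : ℝ) + 1) ^ 2 * ((i.1 : ℝ) + i.2 + 2) ^ 2)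
        + 2 * ∑' i : ℕ × ℕ,
          1 / (((i.1 : ℝ) + 1) * ((i.2 : ℝ) + 1) * ((i.1 : ℝ) + i.2 + 2) ^ 2) := by
    rw [← tsum_mul_left, ← hs.tsum_add hs',
      ← (hs.add hs').tsum_add (summable_one_div_mul_add_sq.mul_left 2)]
    refine tsum_congr fun i => ?_
    have h3 : (i.1 : ℝ) + 1 ≠ 0 := by positivity
    have h4 : (i.2 : ℝ) + 1 ≠ 0 := by positivity
    have h5 : (i.1 : ℝ) + i.2 + 2 ≠ 0 := by positivity
    field_simp
    ring
  have h3 := tsum_one_div_add_one_sq_mul_add_sq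
  rw [hswap] at h2
  linarith

theorem tendsto_logSqPrim₂_one :
    Filter.Tendsto (fun x : ℝ => logSqPrim₂ x) (nhdsWithin 1 (Iio 1)) (nhds (riemannZeta 4 / 2)) := by
  have hval : riemannZeta 4 / 2 = ∑' i : ℕ × ℕ,
      1 / (((i.1 : ℂ) + 1) * ((i.2 : ℂ) + 1) * ((i.1 : ℂ) + i.2 + 2) ^ 2) := by
    have h := congrArg (fun x : ℝ => (x : ℂ)) tsum_one_div_mul_add_sq
    simp only [Complex.ofReal_tsum, Complex.ofReal_div] at h
    push_cast at h
    rw [h]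
    congr 1
    exact_mod_cast riemannZeta_nat_eq_tsum 4 (by norm_num)
  rw [hval]
  have hev : ∀ᶠ x : ℝ in nhdsWithin 1 (Iio 1), 0 < x ∧ x < 1 := by
    filter_upwards [nhdsWithin_le_nhds (lt_mem_nhds zero_lt_one), self_mem_nhdsWithin] with x h h'
    exact ⟨h, h'⟩
  have h : Filter.Tendsto (fun x : ℝ => ∑' i : ℕ × ℕ,
      1 / (((i.1 : ℂ) + 1) * ((i.2 : ℂ) + 1) * ((i.1 : ℂ) + i.2 + 2) ^ 2)
        * (x : ℂ) ^ (i.1 + i.2 + 1 + 1))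
      (nhdsWithin 1 (Iio 1)) (nhds (∑' i : ℕ × ℕ,
      1 / (((i.1 : ℂ) + 1) * ((i.2 : ℂ) + 1) * ((i.1 : ℂ) + i.2 + 2) ^ 2))) := by
    refine tendsto_tsum_of_dominated_convergence summable_one_div_mul_add_sq (fun i => ?_) ?_
    · have : Continuous fun x : ℝ =>
        1 / (((i.1 : ℂ) + 1) * ((i.2 : ℂ) + 1) * ((i.1 : ℂ) + i.2 + 2) ^ 2)
          * (x : ℂ) ^ (i.1 + i.2 + 1 + 1) := by fun_prop
      simpa using (this.tendsto 1).mono_left nhdsWithin_le_nhds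
    · filter_upwards [hev] with x hx i
      have h6 : ‖(i.1 : ℂ) + i.2 + 2‖ = (i.1 : ℝ) + i.2 + 2 := by
        exact_mod_cast Complex.norm_natCast (i.1 + i.2 + 2)
      rw [norm_mul, norm_div, norm_mul, norm_mul, norm_pow, norm_pow, norm_natCast_add_one,
        norm_natCast_add_one, norm_one, h6, Complex.norm_real, Real.norm_eq_abs, abs_of_pos hx.1]
      exact mul_le_of_le_one_right (by positivity) (pow_le_one₀ hx.1.le hx.2.le)
  refine h.congr' ?_
  filter_upwards [hev] with x hx
  refine (hasSum_logSqPrim₂ ?_).tsum_eq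
  rw [Complex.norm_real, Real.norm_eq_abs, abs_of_pos hx.1]
  exact hx.2

/-! ### Functional equations of the polylogarithms -/

section

open Filter Topology

variable {z : ℂ}

theorem hasDerivAt_log (hz : z ∈ cutPlane₀₁) : HasDerivAt (fun z => Complex.log z) z⁻¹ z :=
  hasDerivAt_log_comp (hasDerivAt_id_dlog (Complex.slitPlane_ne_zero hz.2)) hz.2

theorem hasDerivAt_log_one_sub (hz : z ∈ polylogDomain) :
    HasDerivAt (fun z => Complex.log (1 - z)) (-(1 - z)⁻¹) z :=
  hasDerivAt_log_comp (hasDerivAt_one_sub_dlog (one_sub_ne_zero_of_mem hz)) hz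

theorem hasDerivAt_log_one_add (hz : z ∈ cutPlanePM) :
    HasDerivAt (fun z => Complex.log (1 + z)) (1 + z)⁻¹ z :=
  hasDerivAt_log_comp (hasDerivAt_one_add_dlog (one_add_ne_zero_of_mem hz))
    (one_add_mem_slitPlane hz)

theorem tendsto_ofReal_nhdsGT_zero :
    Tendsto (fun x : ℝ => (x : ℂ)) (𝓝[>] 0) (𝓝 0) := by
  have := (Complex.continuous_ofReal.tendsto 0).mono_left (nhdsWithin_le_nhds (s := Ioi (0 : ℝ)))
  simpa using this

theorem eventually_ofReal_mem_cutPlane₀₁ : ∀ᶠ x : ℝ in 𝓝[>] 0, (x : ℂ) ∈ cutPlane₀₁ := by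
  filter_upwards [self_mem_nhdsWithin, nhdsWithin_le_nhds (gt_mem_nhds zero_lt_one)] with x h h'
  exact mem_cutPlane₀₁_iff.2 (Or.inl ⟨by simpa using h, by simpa using h'⟩)

theorem tendsto_one_sub_nhdsGT_zero : Tendsto (fun x : ℝ => 1 - x) (𝓝[>] 0) (𝓝[<] 1) := by
  refine tendsto_nhdsWithin_iff.2 ⟨?_, ?_⟩
  · have : Tendsto (fun x : ℝ => 1 - x) (𝓝 0) (𝓝 (1 - 0)) := (continuous_const.sub continuous_id).tendsto 0
    rw [sub_zero] at this
    exact this.mono_left nhdsWithin_le_nhds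
  · filter_upwards [self_mem_nhdsWithin] with x hx
    simpa using hx

theorem tendsto_polylog_one_sub (n : ℕ) (hn : 2 ≤ n) :
    Tendsto (fun x : ℝ => polylog n (1 - x)) (𝓝[>] 0) (𝓝 (riemannZeta n)) := by
  have := (tendsto_polylog_one n hn).comp tendsto_one_sub_nhdsGT_zero
  simpa [Function.comp_def] using this

theorem tendsto_of_continuousAt_zero {f : ℂ → ℂ} (hf : ContinuousAt f 0) :
    Tendsto (fun x : ℝ => f x) (𝓝[>] 0) (𝓝 (f 0)) :=
  hf.tendsto.comp tendsto_ofReal_nhdsGT_zero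

theorem differentiableAt_zero_of_differentiableOn {f : ℂ → ℂ}
    (hf : DifferentiableOn ℂ f polylogDomain) : DifferentiableAt ℂ f 0 :=
  hf.differentiableAt (isOpen_polylogDomain.mem_nhds zero_mem_polylogDomain)

theorem tendsto_polylog_zero (n : ℕ) : Tendsto (polylog n) (𝓝 0) (𝓝 0) := by
  have := (differentiableAt_zero_of_differentiableOn (differentiableOn_polylog n)).continuousAt.tendsto
  rwa [polylog_zero_right] at this

theorem tendsto_log_one_sub_zero : Tendsto (fun z : ℂ => Complex.log (1 - z)) (𝓝 0) (𝓝 0) := by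
  have := (differentiableAt_zero_of_differentiableOn differentiableOn_log_one_sub).continuousAt.tendsto
  simpa using this

theorem tendsto_log_pow_mul_log_one_sub (k : ℕ) :
    Tendsto (fun z : ℂ => Complex.log z ^ (k + 1) * Complex.log (1 - z)) (𝓝 0) (𝓝 0) :=
  tendsto_log_pow_mul k (differentiableAt_zero_of_differentiableOn differentiableOn_log_one_sub)
    (by simp)

theorem tendsto_log_mul_log_one_sub :
    Tendsto (fun z : ℂ => Complex.log z * Complex.log (1 - z)) (𝓝 0) (𝓝 0) := by
  simpa using tendsto_log_pow_mul_log_one_sub 0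

theorem polylog_two_reflection (hz : z ∈ cutPlane₀₁) :
    polylog 2 z + polylog 2 (1 - z) + Complex.log z * Complex.log (1 - z) = riemannZeta 2 := by
  refine eq_of_tendsto_of_hasDerivAt_zero isOpen_cutPlane₀₁ isPreconnected_cutPlane₀₁
    (F := fun z => polylog 2 z + polylog 2 (1 - z) + Complex.log z * Complex.log (1 - z))
    (fun z hz => ?_) eventually_ofReal_mem_cutPlane₀₁ ?_ hz
  · have h0 := Complex.slitPlane_ne_zero hz.2
    have h1 := one_sub_ne_zero_of_mem hz.1
    have hz' := one_sub_mem_cutPlane₀₁ hz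
    refine (((hasDerivAt_polylog_comp 1 (hasDerivAt_id_dlog h0) hz.1 h0).add
      (hasDerivAt_polylog_comp 1 (hasDerivAt_one_sub_dlog h1) hz'.1 h1)).add
      ((hasDerivAt_log hz).mul (hasDerivAt_log_one_sub hz.1))).congr_deriv ?_
    rw [polylog_one hz.1, polylog_one hz'.1, sub_sub_cancel]
    ring
  · have h := (((tendsto_polylog_zero 2).comp tendsto_ofReal_nhdsGT_zero).add
      (tendsto_polylog_one_sub 2 le_rfl)).add
      (tendsto_log_mul_log_one_sub.comp tendsto_ofReal_nhdsGT_zero)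
    simpa [Function.comp_def] using h

theorem differentiableOn_landen : DifferentiableOn ℂ (fun z : ℂ => z / (z - 1)) polylogDomain := by
  intro z hz
  have h1 : z - 1 ≠ 0 := by
    rw [← neg_sub]
    exact neg_ne_zero.2 (one_sub_ne_zero_of_mem hz)
  have h2 : DifferentiableAt ℂ (fun z : ℂ => z / (z - 1)) z := by fun_prop (disch := exact h1)
  exact h2.differentiableWithinAt

theorem DifferentiableOn.comp_landen {f : ℂ → ℂ} (hf : DifferentiableOn ℂ f polylogDomain) :
    DifferentiableOn ℂ (fun z => f (z / (z - 1))) polylogDomain :=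
  hf.comp differentiableOn_landen fun _ hz => landen_mem_polylogDomain hz

theorem landen_ne_zero (h0 : z ≠ 0) (hz : z ∈ polylogDomain) : z / (z - 1) ≠ 0 := by
  refine div_ne_zero h0 ?_
  rw [← neg_sub]
  exact neg_ne_zero.2 (one_sub_ne_zero_of_mem hz)

/-- Under `z ↦ z/(z-1)` the function `log (1 - z)` changes sign and `dz/z` becomes `dz/z +
dz/(1-z)`; the extra term integrates to a power of `log (1 - z)`. The other Landen formulas have the
same source. -/
theorem polylog_two_landen (hz : z ∈ polylogDomain) :
    polylog 2 (z / (z - 1)) = -polylog 2 z - Complex.log (1 - z) ^ 2 / 2 := by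
  have h := eq_of_hasDerivAt_zero isOpen_polylogDomain isPreconnected_polylogDomain
    (F := fun z => polylog 2 (z / (z - 1)) + polylog 2 z + Complex.log (1 - z) ^ 2 / 2)
    (((differentiableOn_polylog 2).comp_landen.add (differentiableOn_polylog 2)).add
      ((differentiableOn_log_one_sub.pow 2).div_const 2)) (fun z hz h0 => ?_) hz
    zero_mem_polylogDomain
  · simp [polylog_zero_right] at h
    linear_combination h
  · have h1 := one_sub_ne_zero_of_mem hz
    refine (((hasDerivAt_polylog_comp 1 (hasDerivAt_landen_dlog h0 h1)
      (landen_mem_polylogDomain hz) (landen_ne_zero h0 hz)).add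
      (hasDerivAt_polylog_comp 1 (hasDerivAt_id_dlog h0) hz h0)).add
      (((hasDerivAt_log_one_sub hz).pow 2).div_const 2)).congr_deriv ?_
    rw [polylog_one hz, polylog_one (landen_mem_polylogDomain hz), log_one_sub_landen hz]
    push_cast
    ring

theorem logSqPrim_landen (hz : z ∈ polylogDomain) :
    logSqPrim (z / (z - 1)) = logSqPrim z - Complex.log (1 - z) ^ 3 / 3 := by
  have h := eq_of_hasDerivAt_zero isOpen_polylogDomain isPreconnected_polylogDomain
    (F := fun z => logSqPrim (z / (z - 1)) - logSqPrim z + Complex.log (1 - z) ^ 3 / 3)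
    ((differentiableOn_logSqPrim.comp_landen.sub differentiableOn_logSqPrim).add
      ((differentiableOn_log_one_sub.pow 3).div_const 3)) (fun z hz h0 => ?_) hz
    zero_mem_polylogDomain
  · simp at h
    linear_combination h
  · have h1 := one_sub_ne_zero_of_mem hz
    refine (((hasDerivAt_logSqPrim_comp (hasDerivAt_landen_dlog h0 h1)
      (landen_mem_polylogDomain hz) (landen_ne_zero h0 hz)).sub
      (hasDerivAt_logSqPrim_comp (hasDerivAt_id_dlog h0) hz h0)).add
      (((hasDerivAt_log_one_sub hz).pow 3).div_const 3)).congr_deriv ?_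
    rw [log_one_sub_landen hz]
    push_cast
    ring

theorem logCubePrim_landen (hz : z ∈ polylogDomain) :
    logCubePrim (z / (z - 1)) = -logCubePrim z + Complex.log (1 - z) ^ 4 / 4 := by
  have h := eq_of_hasDerivAt_zero isOpen_polylogDomain isPreconnected_polylogDomain
    (F := fun z => logCubePrim (z / (z - 1)) + logCubePrim z - Complex.log (1 - z) ^ 4 / 4)
    ((differentiableOn_logCubePrim.comp_landen.add differentiableOn_logCubePrim).sub
      ((differentiableOn_log_one_sub.pow 4).div_const 4)) (fun z hz h0 => ?_) hz
    zero_mem_polylogDomain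
  · simp at h
    linear_combination h
  · have h1 := one_sub_ne_zero_of_mem hz
    refine (((hasDerivAt_logCubePrim_comp (hasDerivAt_landen_dlog h0 h1)
      (landen_mem_polylogDomain hz) (landen_ne_zero h0 hz)).add
      (hasDerivAt_logCubePrim_comp (hasDerivAt_id_dlog h0) hz h0)).sub
      (((hasDerivAt_log_one_sub hz).pow 4).div_const 4)).congr_deriv ?_
    rw [log_one_sub_landen hz]
    push_cast
    ring

/-- The extra differential `dz/(1-z)` now multiplies `logSqPrim`; integrating by parts produces the
product with `log (1 - z)` and the `logCubePrim` term. -/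
theorem logSqPrim₂_landen (hz : z ∈ polylogDomain) :
    logSqPrim₂ (z / (z - 1)) = logSqPrim₂ z + 2 / 3 * logCubePrim z
      + Complex.log (1 - z) ^ 4 / 12 - Complex.log (1 - z) * logSqPrim z := by
  have h := eq_of_hasDerivAt_zero isOpen_polylogDomain isPreconnected_polylogDomain
    (F := fun z => logSqPrim₂ (z / (z - 1)) - logSqPrim₂ z - 2 / 3 * logCubePrim z
      - Complex.log (1 - z) ^ 4 / 12 + Complex.log (1 - z) * logSqPrim z)
    ((((differentiableOn_logSqPrim₂.comp_landen.sub differentiableOn_logSqPrim₂).sub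
      (differentiableOn_logCubePrim.const_mul _)).sub
      ((differentiableOn_log_one_sub.pow 4).div_const 12)).add
      (differentiableOn_log_one_sub.mul differentiableOn_logSqPrim)) (fun z hz h0 => ?_) hz
    zero_mem_polylogDomain
  · simp at h
    linear_combination h
  · have h1 := one_sub_ne_zero_of_mem hz
    refine (((((hasDerivAt_logSqPrim₂_comp (hasDerivAt_landen_dlog h0 h1)
      (landen_mem_polylogDomain hz) (landen_ne_zero h0 hz)).sub
      (hasDerivAt_logSqPrim₂_comp (hasDerivAt_id_dlog h0) hz h0)).sub
      ((hasDerivAt_logCubePrim_comp (hasDerivAt_id_dlog h0) hz h0).const_mul _)).sub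
      (((hasDerivAt_log_one_sub hz).pow 4).div_const 12)).add
      ((hasDerivAt_log_one_sub hz).mul
        (hasDerivAt_logSqPrim_comp (hasDerivAt_id_dlog h0) hz h0))).congr_deriv ?_
    rw [logSqPrim_landen hz]
    push_cast
    ring

/-- After the dilogarithm Landen formula is inserted, the derivative of the difference is a multiple
of the dilogarithm reflection formula. The constant is the limit at `0` along the positive reals. -/
theorem polylog_three_three_term (hz : z ∈ cutPlane₀₁) :
    polylog 3 z + polylog 3 (1 - z) + polylog 3 (z / (z - 1)) = riemannZeta 3
      + Complex.log (1 - z) ^ 3 / 6 + riemannZeta 2 * Complex.log (1 - z)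
      - Complex.log z * Complex.log (1 - z) ^ 2 / 2 := by
  have h := eq_of_tendsto_of_hasDerivAt_zero isOpen_cutPlane₀₁ isPreconnected_cutPlane₀₁
    (F := fun z => polylog 3 z + polylog 3 (1 - z) + polylog 3 (z / (z - 1))
      - Complex.log (1 - z) ^ 3 / 6 - riemannZeta 2 * Complex.log (1 - z)
      + Complex.log z * Complex.log (1 - z) ^ 2 / 2)
    (c := riemannZeta 3)
    (fun z hz => ?_) eventually_ofReal_mem_cutPlane₀₁ ?_ hz
  · linear_combination h
  · have h0 := Complex.slitPlane_ne_zero hz.2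
    have h1 := one_sub_ne_zero_of_mem hz.1
    have hz' := one_sub_mem_cutPlane₀₁ hz
    have hl := hasDerivAt_log hz
    have hb := hasDerivAt_log_one_sub hz.1
    refine ((((((hasDerivAt_polylog_comp 2 (hasDerivAt_id_dlog h0) hz.1 h0).add
      (hasDerivAt_polylog_comp 2 (hasDerivAt_one_sub_dlog h1) hz'.1 h1)).add
      (hasDerivAt_polylog_comp 2 (hasDerivAt_landen_dlog h0 h1)
      (landen_mem_polylogDomain hz.1) (landen_ne_zero h0 hz.1))).sub ((hb.pow 3).div_const 6)).sub
      (hb.const_mul (riemannZeta 2))).add ((hl.mul (hb.pow 2)).div_const 2)).congr_deriv ?_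
    rw [polylog_two_landen hz.1]
    push_cast
    simp only [Pi.pow_apply]
    linear_combination (-(1 - z)⁻¹) * polylog_two_reflection hz
  · have hb := tendsto_log_one_sub_zero.comp tendsto_ofReal_nhdsGT_zero
    have hv : Tendsto (fun x : ℝ => polylog 3 ((x : ℂ) / (x - 1))) (𝓝[>] 0) (𝓝 0) := by
      have := tendsto_of_continuousAt_zero (differentiableAt_zero_of_differentiableOn
        (differentiableOn_polylog 3).comp_landen).continuousAt
      simpa [polylog_zero_right] using this
    have h := ((((((tendsto_polylog_zero 3).comp tendsto_ofReal_nhdsGT_zero).add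
      (tendsto_polylog_one_sub 3 (by norm_num))).add hv).sub ((hb.pow 3).div_const 6)).sub
      (hb.const_mul (riemannZeta 2))).add
      (((tendsto_log_mul_log_one_sub.comp tendsto_ofReal_nhdsGT_zero).mul hb).div_const 2)
    simp only [Function.comp_def] at h
    refine (h.congr fun x => ?_).trans_eq ?_
    · ring
    · simp

/-- Repeated integration by parts, each step lowering the power of `log (1 - z)` and raising the
polylogarithm order at `1 - z`; the zeta value fixes the constant at `0`. The cubic analogue below
has the same form. -/
theorem logSqPrim_eq (hz : z ∈ cutPlane₀₁) :
    logSqPrim z = Complex.log z * Complex.log (1 - z) ^ 2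
      + 2 * Complex.log (1 - z) * polylog 2 (1 - z) - 2 * polylog 3 (1 - z)
      + 2 * riemannZeta 3 := by
  have h := eq_of_tendsto_of_hasDerivAt_zero isOpen_cutPlane₀₁ isPreconnected_cutPlane₀₁
    (F := fun z => logSqPrim z - Complex.log z * Complex.log (1 - z) ^ 2
      - 2 * (Complex.log (1 - z) * polylog 2 (1 - z)) + 2 * polylog 3 (1 - z))
    (c := 2 * riemannZeta 3)
    (fun z hz => ?_) eventually_ofReal_mem_cutPlane₀₁ ?_ hz
  · linear_combination h
  · have h0 := Complex.slitPlane_ne_zero hz.2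
    have h1 := one_sub_ne_zero_of_mem hz.1
    have hz' := one_sub_mem_cutPlane₀₁ hz
    have hl := hasDerivAt_log hz
    have hb := hasDerivAt_log_one_sub hz.1
    have h2 := hasDerivAt_polylog_comp 1 (hasDerivAt_one_sub_dlog h1) hz'.1 h1
    have h3 := hasDerivAt_polylog_comp 2 (hasDerivAt_one_sub_dlog h1) hz'.1 h1
    refine ((((hasDerivAt_logSqPrim_comp (hasDerivAt_id_dlog h0) hz.1 h0).sub
      (hl.mul (hb.pow 2))).sub ((hb.mul h2).const_mul 2)).add (h3.const_mul 2)).congr_deriv ?_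
    rw [polylog_one hz'.1, sub_sub_cancel]
    push_cast
    simp only [Pi.pow_apply]
    ring
  · have hb := tendsto_log_one_sub_zero.comp tendsto_ofReal_nhdsGT_zero
    have h0 := tendsto_of_continuousAt_zero
      (differentiableAt_zero_of_differentiableOn differentiableOn_logSqPrim).continuousAt
    have h := ((h0.sub ((tendsto_log_mul_log_one_sub.comp tendsto_ofReal_nhdsGT_zero).mul hb)).sub
      ((hb.mul (tendsto_polylog_one_sub 2 le_rfl)).const_mul 2)).add
      ((tendsto_polylog_one_sub 3 (by norm_num)).const_mul 2)
    simp only [Function.comp_def] at h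
    refine (h.congr fun x => ?_).trans_eq ?_
    · ring
    · simp

theorem logCubePrim_eq (hz : z ∈ cutPlane₀₁) :
    logCubePrim z = Complex.log z * Complex.log (1 - z) ^ 3
      + 3 * Complex.log (1 - z) ^ 2 * polylog 2 (1 - z)
      - 6 * Complex.log (1 - z) * polylog 3 (1 - z) + 6 * polylog 4 (1 - z)
      - 6 * riemannZeta 4 := by
  have h := eq_of_tendsto_of_hasDerivAt_zero isOpen_cutPlane₀₁ isPreconnected_cutPlane₀₁
    (F := fun z => logCubePrim z - Complex.log z * Complex.log (1 - z) ^ 3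
      - 3 * (Complex.log (1 - z) ^ 2 * polylog 2 (1 - z))
      + 6 * (Complex.log (1 - z) * polylog 3 (1 - z)) - 6 * polylog 4 (1 - z))
    (c := -(6 * riemannZeta 4))
    (fun z hz => ?_) eventually_ofReal_mem_cutPlane₀₁ ?_ hz
  · linear_combination h
  · have h0 := Complex.slitPlane_ne_zero hz.2
    have h1 := one_sub_ne_zero_of_mem hz.1
    have hz' := one_sub_mem_cutPlane₀₁ hz
    have hl := hasDerivAt_log hz
    have hb := hasDerivAt_log_one_sub hz.1
    have h2 := hasDerivAt_polylog_comp 1 (hasDerivAt_one_sub_dlog h1) hz'.1 h1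
    have h3 := hasDerivAt_polylog_comp 2 (hasDerivAt_one_sub_dlog h1) hz'.1 h1
    have h4 := hasDerivAt_polylog_comp 3 (hasDerivAt_one_sub_dlog h1) hz'.1 h1
    refine (((((hasDerivAt_logCubePrim_comp (hasDerivAt_id_dlog h0) hz.1 h0).sub
      (hl.mul (hb.pow 3))).sub (((hb.pow 2).mul h2).const_mul 3)).add
      ((hb.mul h3).const_mul 6)).sub (h4.const_mul 6)).congr_deriv ?_
    rw [polylog_one hz'.1, sub_sub_cancel]
    push_cast
    simp only [Pi.pow_apply]
    ring
  · have hb := tendsto_log_one_sub_zero.comp tendsto_ofReal_nhdsGT_zero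
    have h0 := tendsto_of_continuousAt_zero
      (differentiableAt_zero_of_differentiableOn differentiableOn_logCubePrim).continuousAt
    have h := (((h0.sub
      ((tendsto_log_mul_log_one_sub.comp tendsto_ofReal_nhdsGT_zero).mul (hb.pow 2))).sub
      (((hb.pow 2).mul (tendsto_polylog_one_sub 2 le_rfl)).const_mul 3)).add
      ((hb.mul (tendsto_polylog_one_sub 3 (by norm_num))).const_mul 6)).sub
      ((tendsto_polylog_one_sub 4 (by norm_num)).const_mul 6)
    simp only [Function.comp_def] at h
    refine (h.congr fun x => ?_).trans_eq ?_
    · ring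
    · simp

/-! ### Limits at `1` -/

theorem tendsto_one_sub_nhdsWithin_one :
    Tendsto (fun z : ℂ => 1 - z) (𝓝[polylogDomain] 1) (𝓝 0) := by
  have : Tendsto (fun z : ℂ => 1 - z) (𝓝 1) (𝓝 (1 - 1)) :=
    (continuous_const.sub continuous_id).tendsto 1
  rw [sub_self] at this
  exact this.mono_left nhdsWithin_le_nhds

theorem eventually_mem_cutPlane₀₁ : ∀ᶠ z in 𝓝[polylogDomain] 1, z ∈ cutPlane₀₁ := by
  filter_upwards [self_mem_nhdsWithin, nhdsWithin_le_nhds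
    (Complex.isOpen_slitPlane.mem_nhds Complex.one_mem_slitPlane)] with z h h'
  exact ⟨h, h'⟩

theorem tendsto_log_nhdsWithin_one :
    Tendsto (fun z : ℂ => Complex.log z) (𝓝[polylogDomain] 1) (𝓝 0) := by
  have := (continuousAt_clog Complex.one_mem_slitPlane).tendsto.mono_left
    (nhdsWithin_le_nhds (s := polylogDomain))
  simpa using this

theorem tendsto_log_one_sub_pow_mul_polylog (k n : ℕ) :
    Tendsto (fun z : ℂ => Complex.log (1 - z) ^ (k + 1) * polylog n (1 - z))
      (𝓝[polylogDomain] 1) (𝓝 0) :=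
  (tendsto_log_pow_mul k (differentiableAt_zero_of_differentiableOn (differentiableOn_polylog n))
    (polylog_zero_right n)).comp tendsto_one_sub_nhdsWithin_one

theorem tendsto_log_mul_log_one_sub_pow (k : ℕ) :
    Tendsto (fun z : ℂ => Complex.log z * Complex.log (1 - z) ^ (k + 1))
      (𝓝[polylogDomain] 1) (𝓝 0) := by
  have := (tendsto_log_pow_mul_log_one_sub k).comp tendsto_one_sub_nhdsWithin_one
  simp only [Function.comp_def, sub_sub_cancel] at this
  simpa only [mul_comm] using this

/-- The limit is taken through the whole cut plane, because later `1` is also approached along the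
unit circle, by `(1 - it)/(1 + it)`. -/
theorem tendsto_logSqPrim_one :
    Tendsto logSqPrim (𝓝[polylogDomain] 1) (𝓝 (2 * riemannZeta 3)) := by
  have h := (((tendsto_log_mul_log_one_sub_pow 1).add
    ((tendsto_log_one_sub_pow_mul_polylog 0 2).const_mul 2)).sub
    (((tendsto_polylog_zero 3).comp tendsto_one_sub_nhdsWithin_one).const_mul 2)).add_const
    (2 * riemannZeta 3)
  simp only [mul_zero, add_zero, sub_zero, zero_add, Function.comp_def] at h
  refine h.congr' ?_
  filter_upwards [eventually_mem_cutPlane₀₁] with z hz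
  rw [logSqPrim_eq hz]
  ring

theorem tendsto_logCubePrim_one :
    Tendsto logCubePrim (𝓝[polylogDomain] 1) (𝓝 (-(6 * riemannZeta 4))) := by
  have h := ((((tendsto_log_mul_log_one_sub_pow 2).add
    ((tendsto_log_one_sub_pow_mul_polylog 1 2).const_mul 3)).sub
    ((tendsto_log_one_sub_pow_mul_polylog 0 3).const_mul 6)).add
    (((tendsto_polylog_zero 4).comp tendsto_one_sub_nhdsWithin_one).const_mul 6)).sub_const
    (6 * riemannZeta 4)
  simp only [mul_zero, add_zero, sub_zero, zero_sub, Function.comp_def] at h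
  refine h.congr' ?_
  filter_upwards [eventually_mem_cutPlane₀₁] with z hz
  rw [logCubePrim_eq hz]
  ring

theorem tendsto_ofReal_one_sub_nhdsWithin_one :
    Tendsto (fun x : ℝ => 1 - (x : ℂ)) (𝓝[>] 0) (𝓝[polylogDomain] 1) := by
  refine tendsto_nhdsWithin_iff.2 ⟨?_, ?_⟩
  · simpa using tendsto_ofReal_nhdsGT_zero.const_sub 1
  · filter_upwards [eventually_ofReal_mem_cutPlane₀₁] with x hx
    exact (one_sub_mem_cutPlane₀₁ hx).1

/-- The derivative of `log z * logSqPrim z - logSqPrim₂ z` is `log z * log (1 - z) ^ 2 / z`. Adding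
its image under `z ↦ 1 - z` gives the exact derivative of `log z ^ 2 * log (1 - z) ^ 2 / 2`. The
double-series value at `1` provides the constant. -/
theorem logSqPrim₂_reflection (hz : z ∈ cutPlane₀₁) :
    Complex.log z * logSqPrim z - logSqPrim₂ z
      + (Complex.log (1 - z) * logSqPrim (1 - z) - logSqPrim₂ (1 - z))
      = Complex.log z ^ 2 * Complex.log (1 - z) ^ 2 / 2 - riemannZeta 4 / 2 := by
  have h := eq_of_tendsto_of_hasDerivAt_zero isOpen_cutPlane₀₁ isPreconnected_cutPlane₀₁
    (F := fun z => Complex.log z * logSqPrim z - logSqPrim₂ z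
      + (Complex.log (1 - z) * logSqPrim (1 - z) - logSqPrim₂ (1 - z))
      - Complex.log z ^ 2 * Complex.log (1 - z) ^ 2 / 2)
    (c := -(riemannZeta 4 / 2))
    (fun z hz => ?_) eventually_ofReal_mem_cutPlane₀₁ ?_ hz
  · linear_combination h
  · have h0 := Complex.slitPlane_ne_zero hz.2
    have h1 := one_sub_ne_zero_of_mem hz.1
    have hz' := one_sub_mem_cutPlane₀₁ hz
    have hl := hasDerivAt_log hz
    have hb := hasDerivAt_log_one_sub hz.1
    have h2 := hasDerivAt_logSqPrim_comp (hasDerivAt_id_dlog h0) hz.1 h0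
    have h3 := hasDerivAt_logSqPrim₂_comp (hasDerivAt_id_dlog h0) hz.1 h0
    have h2' := hasDerivAt_logSqPrim_comp (hasDerivAt_one_sub_dlog h1) hz'.1 h1
    have h3' := hasDerivAt_logSqPrim₂_comp (hasDerivAt_one_sub_dlog h1) hz'.1 h1
    refine ((((hl.mul h2).sub h3).add ((hb.mul h2').sub h3')).sub
      (((hl.pow 2).mul (hb.pow 2)).div_const 2)).congr_deriv ?_
    rw [sub_sub_cancel]
    push_cast
    simp only [Pi.pow_apply]
    ring
  · have hb := tendsto_log_one_sub_zero.comp tendsto_ofReal_nhdsGT_zero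
    have h2 := (tendsto_log_mul (differentiableAt_zero_of_differentiableOn
      differentiableOn_logSqPrim) logSqPrim_zero).comp tendsto_ofReal_nhdsGT_zero
    have h3 := tendsto_of_continuousAt_zero
      (differentiableAt_zero_of_differentiableOn differentiableOn_logSqPrim₂).continuousAt
    have h2' := tendsto_logSqPrim_one.comp tendsto_ofReal_one_sub_nhdsWithin_one
    have h3' : Tendsto (fun x : ℝ => logSqPrim₂ (1 - x)) (𝓝[>] 0) (𝓝 (riemannZeta 4 / 2)) := by
      have := tendsto_logSqPrim₂_one.comp tendsto_one_sub_nhdsGT_zero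
      simpa [Function.comp_def] using this
    have h := ((h2.sub h3).add ((hb.mul h2').sub h3')).sub
      (((tendsto_log_mul_log_one_sub.comp tendsto_ofReal_nhdsGT_zero).pow 2).div_const 2)
    simp only [Function.comp_def] at h
    refine (h.congr fun x => ?_).trans_eq ?_
    · ring
    · simp

/-- The double series gives only the limit along the reals; solving the reflection formula for
`logSqPrim₂ z` reduces the general approach to behaviour at `0`. -/
theorem tendsto_logSqPrim₂_nhdsWithin_one :
    Tendsto logSqPrim₂ (𝓝[polylogDomain] 1) (𝓝 (riemannZeta 4 / 2)) := by
  have h2 := (tendsto_log_mul (differentiableAt_zero_of_differentiableOn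
    differentiableOn_logSqPrim) logSqPrim_zero).comp tendsto_one_sub_nhdsWithin_one
  have h3 := (differentiableAt_zero_of_differentiableOn
    differentiableOn_logSqPrim₂).continuousAt.tendsto.comp tendsto_one_sub_nhdsWithin_one
  have h4 := (tendsto_log_mul_log_one_sub.comp tendsto_one_sub_nhdsWithin_one).pow 2
  have h := (((tendsto_log_nhdsWithin_one.mul tendsto_logSqPrim_one).add (h2.sub h3)).sub
    (h4.div_const 2)).add_const (riemannZeta 4 / 2)
  simp only [Function.comp_def, sub_sub_cancel] at h
  refine (h.congr' ?_).trans_eq ?_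
  · filter_upwards [eventually_mem_cutPlane₀₁] with z hz
    linear_combination logSqPrim₂_reflection hz
  · simp

end

section

open Filter Topology

variable {z : ℂ}

/-! ### Duplication -/

theorem DifferentiableOn.comp_neg_cutPlanePM {f : ℂ → ℂ} (hf : DifferentiableOn ℂ f polylogDomain) :
    DifferentiableOn ℂ (fun z => f (-z)) cutPlanePM :=
  hf.comp differentiableOn_id.neg fun _ hz => hz.2

theorem DifferentiableOn.comp_sq_cutPlanePM {f : ℂ → ℂ} (hf : DifferentiableOn ℂ f polylogDomain) :
    DifferentiableOn ℂ (fun z => f (z ^ 2)) cutPlanePM :=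
  hf.comp (differentiableOn_id.pow 2) fun _ hz => sq_mem_polylogDomain hz

theorem DifferentiableOn.mono_cutPlanePM {f : ℂ → ℂ} (hf : DifferentiableOn ℂ f polylogDomain) :
    DifferentiableOn ℂ f cutPlanePM :=
  hf.mono fun _ hz => hz.1

theorem polylog_duplication (n : ℕ) (hz : z ∈ cutPlanePM) :
    polylog (n + 1) z + polylog (n + 1) (-z) = polylog (n + 1) (z ^ 2) / 2 ^ n := by
  induction n generalizing z with
  | zero =>
    rw [polylog_one hz.1, polylog_one hz.2, polylog_one (sq_mem_polylogDomain hz),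
      log_one_sub_sq hz, sub_neg_eq_add]
    ring
  | succ n ih =>
    have h := eq_of_hasDerivAt_zero isOpen_cutPlanePM isPreconnected_cutPlanePM
      (F := fun z => polylog (n + 2) z + polylog (n + 2) (-z) - polylog (n + 2) (z ^ 2) / 2 ^ (n + 1))
      (((differentiableOn_polylog _).mono_cutPlanePM.add
        (differentiableOn_polylog _).comp_neg_cutPlanePM).sub
        ((differentiableOn_polylog _).comp_sq_cutPlanePM.div_const _))
      (fun z hz h0 => ?_) hz zero_mem_cutPlanePM
    · simp [polylog_zero_right] at h
      linear_combination h
    · refine (((hasDerivAt_polylog_comp (n + 1) (hasDerivAt_id_dlog h0) hz.1 h0).add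
        (hasDerivAt_polylog_comp (n + 1) (hasDerivAt_neg_dlog h0) hz.2 (neg_ne_zero.2 h0))).sub
        ((hasDerivAt_polylog_comp (n + 1) (hasDerivAt_sq_dlog z) (sq_mem_polylogDomain hz)
          (pow_ne_zero 2 h0)).div_const _)).congr_deriv ?_
      have e : polylog (n + 1) (z ^ 2) * (2 * z⁻¹) / 2 ^ (n + 1)
          = polylog (n + 1) (z ^ 2) / 2 ^ n * z⁻¹ := by
        field_simp
        ring
      rw [e, ← ih hz]
      ring

theorem neg_one_mem_polylogDomain : (-1 : ℂ) ∈ polylogDomain :=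
  mem_polylogDomain_iff.2 (Or.inl (by norm_num))

/-- The duplication formula in the limit `z → 1` from the left. -/
theorem polylog_neg_one (n : ℕ) (hn : 1 ≤ n) :
    polylog (n + 1) (-1) = riemannZeta (n + 1 : ℕ) / 2 ^ n - riemannZeta (n + 1 : ℕ) := by
  have h1 := tendsto_polylog_one (n + 1) (by omega)
  have hev : ∀ᶠ x : ℝ in 𝓝[<] 1, 0 < x ∧ x < 1 := by
    filter_upwards [nhdsWithin_le_nhds (lt_mem_nhds zero_lt_one), self_mem_nhdsWithin] with x h h'
    exact ⟨h, h'⟩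
  have h2 : Tendsto (fun x : ℝ => polylog (n + 1) (-x)) (𝓝[<] 1) (𝓝 (polylog (n + 1) (-1))) := by
    have hc := ((differentiableOn_polylog (n + 1)).differentiableAt
      (isOpen_polylogDomain.mem_nhds neg_one_mem_polylogDomain)).continuousAt.tendsto
    refine hc.comp ?_
    have : Continuous fun x : ℝ => -(x : ℂ) := by fun_prop
    simpa using (this.tendsto 1).mono_left nhdsWithin_le_nhds
  have h3 : Tendsto (fun x : ℝ => x ^ 2) (𝓝[<] 1) (𝓝[<] 1) := by
    refine tendsto_nhdsWithin_iff.2 ⟨?_, ?_⟩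
    · have : Continuous fun x : ℝ => x ^ 2 := by fun_prop
      simpa using (this.tendsto 1).mono_left nhdsWithin_le_nhds
    · filter_upwards [hev] with x hx
      exact pow_lt_one₀ hx.1.le hx.2 two_ne_zero
  have h4 := ((h1.comp h3).div_const (2 ^ n)).sub h1
  refine tendsto_nhds_unique (h2.congr' ?_) h4
  filter_upwards [hev] with x hx
  have := polylog_duplication n (z := x)
    (mem_cutPlanePM_iff.2 (Or.inl ⟨by simp; linarith, by simpa using hx.2⟩))
  simp only [Function.comp_apply]
  push_cast
  linear_combination this

/-! ### Inversion -/

theorem neg_slitPlane_subset (hz : -z ∈ Complex.slitPlane) : z ∈ polylogDomain := by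
  rw [Complex.mem_slitPlane_iff] at hz
  rw [mem_polylogDomain_iff]
  simp at hz
  rcases hz with h | h
  · left; linarith
  · exact Or.inr h

theorem neg_inv_mem_slitPlane (hz : -z ∈ Complex.slitPlane) : -z⁻¹ ∈ Complex.slitPlane := by
  have := inv_mem_slitPlane hz
  rwa [inv_neg] at this

theorem isOpen_neg_slitPlane : IsOpen {z : ℂ | -z ∈ Complex.slitPlane} :=
  Complex.isOpen_slitPlane.preimage continuous_neg

theorem isPreconnected_neg_slitPlane : IsPreconnected {z : ℂ | -z ∈ Complex.slitPlane} := by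
  have h : IsPreconnected Complex.slitPlane :=
    (Complex.starConvex_one_slitPlane.isPathConnected
      Complex.one_mem_slitPlane).isConnected.isPreconnected
  have := h.image (fun z => -z) continuous_neg.continuousOn
  rwa [image_neg_eq_neg] at this

theorem hasDerivAt_log_neg (hz : -z ∈ Complex.slitPlane) :
    HasDerivAt (fun z => Complex.log (-z)) z⁻¹ z :=
  hasDerivAt_log_comp (hasDerivAt_neg_dlog
    (neg_ne_zero.1 (Complex.slitPlane_ne_zero hz))) hz

theorem log_one_sub_inv (hz : -z ∈ Complex.slitPlane) :
    Complex.log (1 - z⁻¹) = Complex.log (1 - z) - Complex.log (-z) := by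
  have := log_one_add_inv hz
  rwa [inv_neg, ← sub_eq_add_neg, ← sub_eq_add_neg] at this

/-- The point `-1` is its own inverse and `log (-z)` vanishes there, so it fixes the constant. The
formulas of order three and four follow by integrating against `dz/z`, with the same base point. -/
theorem polylog_two_inversion (hz : -z ∈ Complex.slitPlane) :
    polylog 2 z + polylog 2 z⁻¹ = -riemannZeta 2 - Complex.log (-z) ^ 2 / 2 := by
  have hd : ∀ z ∈ {z : ℂ | -z ∈ Complex.slitPlane}, HasDerivAt
      (fun z => polylog 2 z + polylog 2 z⁻¹ + Complex.log (-z) ^ 2 / 2) 0 z := fun z hz => by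
    have h0 : z ≠ 0 := neg_ne_zero.1 (Complex.slitPlane_ne_zero hz)
    have hm := neg_slitPlane_subset hz
    have hm' := neg_slitPlane_subset (neg_inv_mem_slitPlane hz)
    refine (((hasDerivAt_polylog_comp 1 (hasDerivAt_id_dlog h0) hm h0).add
      (hasDerivAt_polylog_comp 1 (hasDerivAt_inv_dlog h0) hm' (inv_ne_zero h0))).add
      (((hasDerivAt_log_neg hz).pow 2).div_const 2)).congr_deriv ?_
    rw [polylog_one hm, polylog_one hm', log_one_sub_inv hz]
    push_cast
    ring
  have h := eq_of_hasDerivAt_zero isOpen_neg_slitPlane isPreconnected_neg_slitPlane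
    (fun z hz => (hd z hz).differentiableAt.differentiableWithinAt) (fun z hz _ => hd z hz) hz
    (y := -1) (by simp)
  have h1 := polylog_neg_one 1 le_rfl
  norm_num at h h1
  rw [h1] at h
  linear_combination h

theorem polylog_three_inversion (hz : -z ∈ Complex.slitPlane) :
    polylog 3 z - polylog 3 z⁻¹
      = -riemannZeta 2 * Complex.log (-z) - Complex.log (-z) ^ 3 / 6 := by
  have hd : ∀ z ∈ {z : ℂ | -z ∈ Complex.slitPlane}, HasDerivAt
      (fun z => polylog 3 z - polylog 3 z⁻¹ + riemannZeta 2 * Complex.log (-z)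
        + Complex.log (-z) ^ 3 / 6) 0 z := fun z hz => by
    have h0 : z ≠ 0 := neg_ne_zero.1 (Complex.slitPlane_ne_zero hz)
    have hm := neg_slitPlane_subset hz
    have hm' := neg_slitPlane_subset (neg_inv_mem_slitPlane hz)
    refine ((((hasDerivAt_polylog_comp 2 (hasDerivAt_id_dlog h0) hm h0).sub
      (hasDerivAt_polylog_comp 2 (hasDerivAt_inv_dlog h0) hm' (inv_ne_zero h0))).add
      ((hasDerivAt_log_neg hz).const_mul _)).add
      (((hasDerivAt_log_neg hz).pow 3).div_const 6)).congr_deriv ?_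
    push_cast
    linear_combination z⁻¹ * polylog_two_inversion hz
  have h := eq_of_hasDerivAt_zero isOpen_neg_slitPlane isPreconnected_neg_slitPlane
    (fun z hz => (hd z hz).differentiableAt.differentiableWithinAt) (fun z hz _ => hd z hz) hz
    (y := -1) (by simp)
  norm_num at h
  linear_combination h

theorem polylog_four_inversion (hz : -z ∈ Complex.slitPlane) :
    polylog 4 z + polylog 4 z⁻¹ = -(7 / 4) * riemannZeta 4
      - riemannZeta 2 * Complex.log (-z) ^ 2 / 2 - Complex.log (-z) ^ 4 / 24 := by
  have hd : ∀ z ∈ {z : ℂ | -z ∈ Complex.slitPlane}, HasDerivAt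
      (fun z => polylog 4 z + polylog 4 z⁻¹ + riemannZeta 2 * (Complex.log (-z) ^ 2 / 2)
        + Complex.log (-z) ^ 4 / 24) 0 z := fun z hz => by
    have h0 : z ≠ 0 := neg_ne_zero.1 (Complex.slitPlane_ne_zero hz)
    have hm := neg_slitPlane_subset hz
    have hm' := neg_slitPlane_subset (neg_inv_mem_slitPlane hz)
    refine ((((hasDerivAt_polylog_comp 3 (hasDerivAt_id_dlog h0) hm h0).add
      (hasDerivAt_polylog_comp 3 (hasDerivAt_inv_dlog h0) hm' (inv_ne_zero h0))).add
      ((((hasDerivAt_log_neg hz).pow 2).div_const 2).const_mul _)).add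
      (((hasDerivAt_log_neg hz).pow 4).div_const 24)).congr_deriv ?_
    push_cast
    linear_combination z⁻¹ * polylog_three_inversion hz
  have h := eq_of_hasDerivAt_zero isOpen_neg_slitPlane isPreconnected_neg_slitPlane
    (fun z hz => (hd z hz).differentiableAt.differentiableWithinAt) (fun z hz _ => hd z hz) hz
    (y := -1) (by simp)
  have h1 := polylog_neg_one 3 (by norm_num)
  norm_num at h h1
  rw [h1] at h
  linear_combination h

/-! ### Primitives on the plane cut along `(-∞, -1]` and `[1, ∞)` -/

/-- `∫_0^z log ((1 + s) / (1 - s)) ^ 2 / s ds` -/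
noncomputable def evenLogSqPrim (z : ℂ) : ℂ :=
  2 * logSqPrim z + 2 * logSqPrim (-z) - logSqPrim (z ^ 2) / 2

/-- The iterated primitive `∫_0^z evenLogSqPrim s / s ds`. -/
noncomputable def evenLogSqPrim₂ (z : ℂ) : ℂ :=
  2 * logSqPrim₂ z + 2 * logSqPrim₂ (-z) - logSqPrim₂ (z ^ 2) / 4

/-- `∫_0^z log (1 - s ^ 2) * log ((1 + s) / (1 - s)) ^ 2 / s ds` -/
noncomputable def evenLogCubePrim (z : ℂ) : ℂ :=
  4 / 3 * (logCubePrim z + logCubePrim (-z)) - logCubePrim (z ^ 2) / 6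

/-- The odd part of `2 * logSqPrim`. -/
noncomputable def oddLogSqPrim (z : ℂ) : ℂ := logSqPrim z - logSqPrim (-z)

/-- The odd part of `2 * polylog n`. -/
noncomputable def oddPolylog (n : ℕ) (z : ℂ) : ℂ := polylog n z - polylog n (-z)

section comp

variable {φ : ℂ → ℂ} {ω : ℂ}

/-- With `a = log (1 - s)` and `b = log (1 + s)`, the coefficients implement `2a² + 2b² - (a+b)² =
(b-a)²`; the last coefficient is halved because `s²` has logarithmic derivative `2/s`. -/
theorem hasDerivAt_evenLogSqPrim_comp (hφ : HasDerivAt φ (φ z * ω) z) (h : φ z ∈ cutPlanePM)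
    (h0 : φ z ≠ 0) :
    HasDerivAt (fun z => evenLogSqPrim (φ z))
      ((Complex.log (1 + φ z) - Complex.log (1 - φ z)) ^ 2 * ω) z := by
  refine ((((hasDerivAt_logSqPrim_comp hφ h.1 h0).const_mul 2).add
    ((hasDerivAt_logSqPrim_comp hφ.neg_dlog h.2 (neg_ne_zero.2 h0)).const_mul 2)).sub
    ((hasDerivAt_logSqPrim_comp hφ.sq_dlog (sq_mem_polylogDomain h)
      (pow_ne_zero 2 h0)).div_const 2)).congr_deriv ?_
  rw [log_one_sub_sq h, sub_neg_eq_add]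
  ring

theorem hasDerivAt_evenLogSqPrim₂_comp (hφ : HasDerivAt φ (φ z * ω) z) (h : φ z ∈ cutPlanePM)
    (h0 : φ z ≠ 0) :
    HasDerivAt (fun z => evenLogSqPrim₂ (φ z)) (evenLogSqPrim (φ z) * ω) z := by
  refine ((((hasDerivAt_logSqPrim₂_comp hφ h.1 h0).const_mul 2).add
    ((hasDerivAt_logSqPrim₂_comp hφ.neg_dlog h.2 (neg_ne_zero.2 h0)).const_mul 2)).sub
    ((hasDerivAt_logSqPrim₂_comp hφ.sq_dlog (sq_mem_polylogDomain h)
      (pow_ne_zero 2 h0)).div_const 4)).congr_deriv ?_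
  rw [evenLogSqPrim]
  ring

/-- With the same `a` and `b`: `4/3 (a³ + b³) - 1/3 (a+b)³ = (a+b)(b-a)²`. -/
theorem hasDerivAt_evenLogCubePrim_comp (hφ : HasDerivAt φ (φ z * ω) z) (h : φ z ∈ cutPlanePM)
    (h0 : φ z ≠ 0) :
    HasDerivAt (fun z => evenLogCubePrim (φ z))
      ((Complex.log (1 + φ z) + Complex.log (1 - φ z))
        * (Complex.log (1 + φ z) - Complex.log (1 - φ z)) ^ 2 * ω) z := by
  refine ((((hasDerivAt_logCubePrim_comp hφ h.1 h0).add
    (hasDerivAt_logCubePrim_comp hφ.neg_dlog h.2 (neg_ne_zero.2 h0))).const_mul (4 / 3)).sub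
    ((hasDerivAt_logCubePrim_comp hφ.sq_dlog (sq_mem_polylogDomain h)
      (pow_ne_zero 2 h0)).div_const 6)).congr_deriv ?_
  rw [log_one_sub_sq h, sub_neg_eq_add]
  ring

theorem hasDerivAt_oddLogSqPrim_comp (hφ : HasDerivAt φ (φ z * ω) z) (h : φ z ∈ cutPlanePM)
    (h0 : φ z ≠ 0) :
    HasDerivAt (fun z => oddLogSqPrim (φ z))
      ((Complex.log (1 - φ z) ^ 2 - Complex.log (1 + φ z) ^ 2) * ω) z := by
  refine ((hasDerivAt_logSqPrim_comp hφ h.1 h0).sub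
    (hasDerivAt_logSqPrim_comp hφ.neg_dlog h.2 (neg_ne_zero.2 h0))).congr_deriv ?_
  rw [sub_neg_eq_add]
  ring

end comp

theorem hasDerivAt_oddPolylog (n : ℕ) (hz : z ∈ cutPlanePM) (h0 : z ≠ 0) :
    HasDerivAt (oddPolylog (n + 1)) (oddPolylog n z * z⁻¹) z := by
  refine ((hasDerivAt_polylog_comp n (hasDerivAt_id_dlog h0) hz.1 h0).sub
    (hasDerivAt_polylog_comp n (hasDerivAt_neg_dlog h0) hz.2
      (neg_ne_zero.2 h0))).congr_deriv ?_
  rw [oddPolylog]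
  ring

theorem cutPlanePM_mem_nhds_zero : cutPlanePM ∈ 𝓝 (0 : ℂ) :=
  isOpen_cutPlanePM.mem_nhds zero_mem_cutPlanePM

theorem differentiableAt_evenLogSqPrim_zero : DifferentiableAt ℂ evenLogSqPrim 0 :=
  (((differentiableOn_logSqPrim.mono_cutPlanePM.const_mul 2).add
    (differentiableOn_logSqPrim.comp_neg_cutPlanePM.const_mul 2)).sub
    (differentiableOn_logSqPrim.comp_sq_cutPlanePM.div_const 2)).differentiableAt
    cutPlanePM_mem_nhds_zero

theorem differentiableAt_evenLogSqPrim₂_zero : DifferentiableAt ℂ evenLogSqPrim₂ 0 :=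
  (((differentiableOn_logSqPrim₂.mono_cutPlanePM.const_mul 2).add
    (differentiableOn_logSqPrim₂.comp_neg_cutPlanePM.const_mul 2)).sub
    (differentiableOn_logSqPrim₂.comp_sq_cutPlanePM.div_const 4)).differentiableAt
    cutPlanePM_mem_nhds_zero

theorem differentiableAt_oddPolylog_zero (n : ℕ) : DifferentiableAt ℂ (oddPolylog n) 0 :=
  ((differentiableOn_polylog n).mono_cutPlanePM.sub
    (differentiableOn_polylog n).comp_neg_cutPlanePM).differentiableAt cutPlanePM_mem_nhds_zero

theorem differentiableAt_log_one_add_sub_zero :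
    DifferentiableAt ℂ (fun z => Complex.log (1 + z) - Complex.log (1 - z)) 0 :=
  ((hasDerivAt_log_one_add zero_mem_cutPlanePM).sub
    (hasDerivAt_log_one_sub zero_mem_polylogDomain)).differentiableAt

@[simp] theorem evenLogSqPrim_zero : evenLogSqPrim 0 = 0 := by simp [evenLogSqPrim]
@[simp] theorem evenLogSqPrim₂_zero : evenLogSqPrim₂ 0 = 0 := by simp [evenLogSqPrim₂]
@[simp] theorem oddPolylog_zero (n : ℕ) : oddPolylog n 0 = 0 := by simp [oddPolylog]

/-! ### Limits of the symmetrised primitives at `1` -/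

section limits

variable {ι : Type*} {l : Filter ι} {φ : ι → ℂ}

theorem tendsto_comp_neg_one {f : ℂ → ℂ} (hf : DifferentiableOn ℂ f polylogDomain)
    (hφ : Tendsto φ l (𝓝 1)) : Tendsto (fun i => f (-φ i)) l (𝓝 (f (-1))) :=
  (hf.differentiableAt (isOpen_polylogDomain.mem_nhds
    neg_one_mem_polylogDomain)).continuousAt.tendsto.comp hφ.neg

theorem tendsto_sq_nhdsWithin_one (hφ : Tendsto φ l (𝓝 1)) (h : ∀ᶠ i in l, φ i ∈ cutPlanePM) :
    Tendsto (fun i => φ i ^ 2) l (𝓝[polylogDomain] 1) := by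
  refine tendsto_nhdsWithin_iff.2 ⟨by simpa using hφ.pow 2, ?_⟩
  filter_upwards [h] with i hi
  exact sq_mem_polylogDomain hi

theorem tendsto_nhdsWithin_one (hφ : Tendsto φ l (𝓝 1)) (h : ∀ᶠ i in l, φ i ∈ cutPlanePM) :
    Tendsto φ l (𝓝[polylogDomain] 1) :=
  tendsto_nhdsWithin_iff.2 ⟨hφ, h.mono fun _ hi => hi.1⟩

theorem tendsto_evenLogSqPrim_one (hφ : Tendsto φ l (𝓝 1)) (h : ∀ᶠ i in l, φ i ∈ cutPlanePM) :
    Tendsto (fun i => evenLogSqPrim (φ i)) l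
      (𝓝 (2 * (2 * riemannZeta 3) + 2 * logSqPrim (-1) - 2 * riemannZeta 3 / 2)) :=
  (((tendsto_logSqPrim_one.comp (tendsto_nhdsWithin_one hφ h)).const_mul 2).add
    ((tendsto_comp_neg_one differentiableOn_logSqPrim hφ).const_mul 2)).sub
    ((tendsto_logSqPrim_one.comp (tendsto_sq_nhdsWithin_one hφ h)).div_const 2)

theorem tendsto_evenLogSqPrim₂_one (hφ : Tendsto φ l (𝓝 1)) (h : ∀ᶠ i in l, φ i ∈ cutPlanePM) :
    Tendsto (fun i => evenLogSqPrim₂ (φ i)) l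
      (𝓝 (2 * (riemannZeta 4 / 2) + 2 * logSqPrim₂ (-1) - riemannZeta 4 / 2 / 4)) :=
  (((tendsto_logSqPrim₂_nhdsWithin_one.comp (tendsto_nhdsWithin_one hφ h)).const_mul 2).add
    ((tendsto_comp_neg_one differentiableOn_logSqPrim₂ hφ).const_mul 2)).sub
    ((tendsto_logSqPrim₂_nhdsWithin_one.comp (tendsto_sq_nhdsWithin_one hφ h)).div_const 4)

theorem tendsto_evenLogCubePrim_one (hφ : Tendsto φ l (𝓝 1)) (h : ∀ᶠ i in l, φ i ∈ cutPlanePM) :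
    Tendsto (fun i => evenLogCubePrim (φ i)) l
      (𝓝 (4 / 3 * (-(6 * riemannZeta 4) + logCubePrim (-1)) - -(6 * riemannZeta 4) / 6)) :=
  (((tendsto_logCubePrim_one.comp (tendsto_nhdsWithin_one hφ h)).add
    (tendsto_comp_neg_one differentiableOn_logCubePrim hφ)).const_mul (4 / 3)).sub
    ((tendsto_logCubePrim_one.comp (tendsto_sq_nhdsWithin_one hφ h)).div_const 6)

theorem tendsto_oddLogSqPrim_one (hφ : Tendsto φ l (𝓝 1)) (h : ∀ᶠ i in l, φ i ∈ cutPlanePM) :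
    Tendsto (fun i => oddLogSqPrim (φ i)) l (𝓝 (2 * riemannZeta 3 - logSqPrim (-1))) :=
  (tendsto_logSqPrim_one.comp (tendsto_nhdsWithin_one hφ h)).sub
    (tendsto_comp_neg_one differentiableOn_logSqPrim hφ)

end limits

theorem tendsto_cayley_zero : Tendsto (fun z : ℂ => (1 - z) / (1 + z)) (𝓝 0) (𝓝 1) := by
  have h : ContinuousAt (fun z : ℂ => (1 - z) / (1 + z)) 0 := by
    fun_prop (disch := simp)
  simpa using h.tendsto

/-! ### The symmetry under `z ↦ (1 - z) / (1 + z)` -/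

theorem one_add_cayley_sub (hz : z ∈ cutPlane₀₁) :
    Complex.log (1 + (1 - z) / (1 + z)) - Complex.log (1 - (1 - z) / (1 + z))
      = -Complex.log z := by
  rw [log_one_add_cayley (cutPlane₀₁_subset_cutPlanePM hz), log_one_sub_cayley hz]
  ring

/-- With `w = (1-z)/(1+z)` and `q = log (1+z) - log (1-z)`, one has `log w = -q`, and the
corresponding difference at `w` is `-log z`. Thus the substitution exchanges `log z` and `q` up to
sign, and the symmetrised integral is the exact primitive of `d(log z ^ 2 * q ^ 2 / 2)`, as in the
reflection formula. -/
theorem evenLogSqPrim_cayley (hz : z ∈ cutPlane₀₁) :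
    Complex.log z * evenLogSqPrim z - evenLogSqPrim₂ z
      + (Complex.log ((1 - z) / (1 + z)) * evenLogSqPrim ((1 - z) / (1 + z))
        - evenLogSqPrim₂ ((1 - z) / (1 + z)))
      = Complex.log z ^ 2 * (Complex.log (1 + z) - Complex.log (1 - z)) ^ 2 / 2
        - 7 / 8 * riemannZeta 4 - 2 * logSqPrim₂ (-1) := by
  rw [log_cayley (cutPlane₀₁_subset_cutPlanePM hz)]
  have h := eq_of_tendsto_of_hasDerivAt_zero isOpen_cutPlane₀₁ isPreconnected_cutPlane₀₁
    (F := fun z => Complex.log z * evenLogSqPrim z - evenLogSqPrim₂ z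
      - ((Complex.log (1 + z) - Complex.log (1 - z)) * evenLogSqPrim ((1 - z) / (1 + z))
        + evenLogSqPrim₂ ((1 - z) / (1 + z)))
      - Complex.log z ^ 2 * (Complex.log (1 + z) - Complex.log (1 - z)) ^ 2 / 2)
    (c := -(2 * (riemannZeta 4 / 2) + 2 * logSqPrim₂ (-1) - riemannZeta 4 / 2 / 4))
    (fun z hz => ?_) eventually_ofReal_mem_cutPlane₀₁ ?_ hz
  · linear_combination h
  · have hp := cutPlane₀₁_subset_cutPlanePM hz
    have h0 := Complex.slitPlane_ne_zero hz.2
    have h1 := one_sub_ne_zero_of_mem hz.1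
    have h2 := one_add_ne_zero_of_mem hp
    have hw := cayley_mem_cutPlane₀₁ hz
    have hwp := cutPlane₀₁_subset_cutPlanePM hw
    have hw0 := Complex.slitPlane_ne_zero hw.2
    have hl := hasDerivAt_log hz
    have hq := (hasDerivAt_log_one_add hp).sub (hasDerivAt_log_one_sub hz.1)
    have hy := hasDerivAt_evenLogSqPrim_comp (hasDerivAt_id_dlog h0) hp h0
    have hy2 := hasDerivAt_evenLogSqPrim₂_comp (hasDerivAt_id_dlog h0) hp h0
    have hyw := hasDerivAt_evenLogSqPrim_comp (hasDerivAt_cayley_dlog h1 h2) hwp hw0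
    have hyw2 := hasDerivAt_evenLogSqPrim₂_comp (hasDerivAt_cayley_dlog h1 h2) hwp hw0
    refine ((((hl.mul hy).sub hy2).sub ((hq.mul hyw).add hyw2)).sub
      (((hl.pow 2).mul (hq.pow 2)).div_const 2)).congr_deriv ?_
    rw [one_add_cayley_sub hz]
    push_cast
    simp only [Pi.pow_apply, Pi.sub_apply]
    ring
  · have hx := tendsto_ofReal_nhdsGT_zero
    have h1 := (tendsto_log_mul differentiableAt_evenLogSqPrim_zero evenLogSqPrim_zero).comp hx
    have h2 := (differentiableAt_evenLogSqPrim₂_zero.continuousAt.tendsto).comp hx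
    have hq := (differentiableAt_log_one_add_sub_zero.continuousAt.tendsto).comp hx
    have hlq := (tendsto_log_mul differentiableAt_log_one_add_sub_zero (by simp)).comp hx
    have hw := tendsto_cayley_zero.comp hx
    have hwm : ∀ᶠ x : ℝ in 𝓝[>] 0, (1 - (x : ℂ)) / (1 + x) ∈ cutPlanePM :=
      eventually_ofReal_mem_cutPlane₀₁.mono fun x hx =>
        cutPlane₀₁_subset_cutPlanePM (cayley_mem_cutPlane₀₁ hx)
    have h := ((h1.sub h2).sub ((hq.mul (tendsto_evenLogSqPrim_one hw hwm)).add
      (tendsto_evenLogSqPrim₂_one hw hwm))).sub ((hlq.pow 2).div_const 2)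
    simp only [Function.comp_def] at h
    refine (h.congr fun x => ?_).trans_eq ?_
    · ring
    · simp

/-! ### The identity on the upper half-plane -/

theorem isOpen_im_pos : IsOpen {z : ℂ | 0 < z.im} := isOpen_lt continuous_const Complex.continuous_im

theorem isPreconnected_im_pos : IsPreconnected {z : ℂ | 0 < z.im} :=
  (convex_halfSpace_im_gt 0).isPreconnected

theorem mem_cutPlane₀₁_of_im_ne_zero (hz : z.im ≠ 0) : z ∈ cutPlane₀₁ :=
  mem_cutPlane₀₁_iff.2 (Or.inr hz)

/-- Centring with `ℓ = log z - η` makes the logarithm differences at `(1-z)/(1+z)` and `(1+z)/(1-z)`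
equal to `-(ℓ+η)` and `-(ℓ-η)`. The `oddLogSqPrim` correction cancels every term in `log 2` and
makes `log (1±z)` occur only through their difference `q`, so the left side has derivative `2(ℓ² -
η²)(q - η)q'`. The right side integrates this by parts. -/
theorem evenLogCubePrim_cayley (hz : 0 < z.im) {η : ℂ} (hη : η = Real.pi / 2 * Complex.I) :
    evenLogCubePrim ((1 - z) / (1 + z)) + evenLogCubePrim ((1 + z) / (1 - z))
      - 2 * η * (oddLogSqPrim ((1 - z) / (1 + z)) - oddLogSqPrim ((1 + z) / (1 - z)))
      = 2 * (4 / 3 * (-(6 * riemannZeta 4) + logCubePrim (-1)) - -(6 * riemannZeta 4) / 6)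
        + (Complex.log z - η) ^ 2 * (Complex.log (1 + z) - Complex.log (1 - z)) ^ 2
        - 2 * ((Complex.log z - η) * evenLogSqPrim z - evenLogSqPrim₂ z)
        - 2 * η * ((Complex.log z - η) ^ 2 * (Complex.log (1 + z) - Complex.log (1 - z))
          - 2 * (Complex.log z - η) * oddPolylog 2 z + 2 * oddPolylog 3 z)
        - η ^ 2 * (Complex.log (1 + z) - Complex.log (1 - z)) ^ 2
        + 2 * η ^ 3 * (Complex.log (1 + z) - Complex.log (1 - z)) := by
  have h := eq_of_tendsto_of_hasDerivAt_zero isOpen_im_pos isPreconnected_im_pos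
    (F := fun z => evenLogCubePrim ((1 - z) / (1 + z)) + evenLogCubePrim ((1 + z) / (1 - z))
      - 2 * η * (oddLogSqPrim ((1 - z) / (1 + z)) - oddLogSqPrim ((1 + z) / (1 - z)))
      - (Complex.log z - η) ^ 2 * (Complex.log (1 + z) - Complex.log (1 - z)) ^ 2
      + 2 * ((Complex.log z - η) * evenLogSqPrim z - evenLogSqPrim₂ z)
      + 2 * η * ((Complex.log z - η) ^ 2 * (Complex.log (1 + z) - Complex.log (1 - z))
          - 2 * ((Complex.log z - η) * oddPolylog 2 z) + 2 * oddPolylog 3 z)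
      + η ^ 2 * (Complex.log (1 + z) - Complex.log (1 - z)) ^ 2
      - 2 * η ^ 3 * (Complex.log (1 + z) - Complex.log (1 - z)))
    (c := 2 * (4 / 3 * (-(6 * riemannZeta 4) + logCubePrim (-1)) - -(6 * riemannZeta 4) / 6))
    (l := 𝓝[>] (0 : ℝ)) (φ := fun t : ℝ => t * Complex.I)
    (fun z hz => ?_) ?_ ?_ hz
  · linear_combination h
  · have hz : 0 < z.im := hz
    have hm := mem_cutPlane₀₁_of_im_ne_zero hz.ne'
    have hm' : -z ∈ cutPlane₀₁ := mem_cutPlane₀₁_of_im_ne_zero (by simpa using hz.ne')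
    have hp := cutPlane₀₁_subset_cutPlanePM hm
    have h0 := Complex.slitPlane_ne_zero hm.2
    have h1 := one_sub_ne_zero_of_mem hm.1
    have h2 := one_add_ne_zero_of_mem hp
    have hw := cayley_mem_cutPlane₀₁ hm
    have hwp := cutPlane₀₁_subset_cutPlanePM hw
    have hw0 := Complex.slitPlane_ne_zero hw.2
    have hv := cayley_mem_cutPlane₀₁ hm'
    rw [sub_neg_eq_add, ← sub_eq_add_neg] at hv
    have hvp := cutPlane₀₁_subset_cutPlanePM hv
    have hv0 := Complex.slitPlane_ne_zero hv.2
    have hvd : HasDerivAt (fun z : ℂ => (1 + z) / (1 - z))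
        ((1 + z) / (1 - z) * ((1 - z)⁻¹ + (1 + z)⁻¹)) z := by
      refine (((hasDerivAt_id z).const_add 1).div ((hasDerivAt_id z).const_sub 1) h1).congr_deriv ?_
      simp only [id]
      field_simp
      ring
    have hm2 := (hasDerivAt_log hm).sub_const η
    have hq := (hasDerivAt_log_one_add hp).sub (hasDerivAt_log_one_sub hm.1)
    have hy := hasDerivAt_evenLogSqPrim_comp (hasDerivAt_id_dlog h0) hp h0
    have hy2 := hasDerivAt_evenLogSqPrim₂_comp (hasDerivAt_id_dlog h0) hp h0
    have hcw := hasDerivAt_evenLogCubePrim_comp (hasDerivAt_cayley_dlog h1 h2) hwp hw0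
    have hcv := hasDerivAt_evenLogCubePrim_comp hvd hvp hv0
    have hsw := hasDerivAt_oddLogSqPrim_comp (hasDerivAt_cayley_dlog h1 h2) hwp hw0
    have hsv := hasDerivAt_oddLogSqPrim_comp hvd hvp hv0
    have hx2 := hasDerivAt_oddPolylog 1 hp h0
    have hx3 := hasDerivAt_oddPolylog 2 hp h0
    have ew1 := log_one_add_cayley hp
    have ew2 := log_one_sub_cayley hm
    have ev1 := log_one_add_cayley (cutPlane₀₁_subset_cutPlanePM hm')
    have ev2 := log_one_sub_cayley hm'
    rw [sub_neg_eq_add, ← sub_eq_add_neg] at ev1 ev2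
    -- The restriction to the upper half-plane is used here, to fix the branch: `log (-z) = log z -
    -- πi`.
    rw [log_neg_of_im_pos hz] at ev2
    have eπ : (Real.pi : ℂ) * Complex.I = 2 * η := by
      rw [hη]
      ring
    rw [eπ] at ev2
    have ex : oddPolylog 1 z = Complex.log (1 + z) - Complex.log (1 - z) := by
      rw [oddPolylog, polylog_one hp.1, polylog_one hp.2, sub_neg_eq_add]
      ring_nf
    rw [ex] at hx2
    refine ((((((((hcw.add hcv).sub ((hsw.sub hsv).const_mul (2 * η))).sub
      ((hm2.pow 2).mul (hq.pow 2))).add (((hm2.mul hy).sub hy2).const_mul 2)).add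
      (((((hm2.pow 2).mul hq).sub ((hm2.mul hx2).const_mul 2)).add
        (hx3.const_mul 2)).const_mul (2 * η))).add
      ((hq.pow 2).const_mul (η ^ 2))).sub (hq.const_mul (2 * η ^ 3)))).congr_deriv ?_
    rw [ew1, ew2, ev1, ev2]
    push_cast
    simp only [Pi.pow_apply, Pi.sub_apply]
    ring
  · filter_upwards [self_mem_nhdsWithin] with t ht
    simpa using ht
  · have hx : Tendsto (fun t : ℝ => (t : ℂ) * Complex.I) (𝓝[>] 0) (𝓝 0) := by
      simpa using tendsto_ofReal_nhdsGT_zero.mul_const Complex.I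
    have him : ∀ᶠ t : ℝ in 𝓝[>] 0, (t * Complex.I : ℂ) ∈ cutPlane₀₁
        ∧ -(t * Complex.I : ℂ) ∈ cutPlane₀₁ := by
      filter_upwards [self_mem_nhdsWithin] with t ht
      have h0 : t ≠ 0 := ne_of_gt ht
      exact ⟨mem_cutPlane₀₁_of_im_ne_zero (by simpa using h0),
        mem_cutPlane₀₁_of_im_ne_zero (by simpa using h0)⟩
    have hw := tendsto_cayley_zero.comp hx
    have hwm := him.mono fun t ht => cutPlane₀₁_subset_cutPlanePM (cayley_mem_cutPlane₀₁ ht.1)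
    have hx' : Tendsto (fun t : ℝ => -((t : ℂ) * Complex.I)) (𝓝[>] 0) (𝓝 0) := by
      simpa using hx.neg
    have hv := tendsto_cayley_zero.comp hx'
    have hvm := him.mono fun t ht => cutPlane₀₁_subset_cutPlanePM (cayley_mem_cutPlane₀₁ ht.2)
    simp only [Function.comp_def, sub_neg_eq_add, ← sub_eq_add_neg] at hv hvm hw
    have hq := (differentiableAt_log_one_add_sub_zero.continuousAt.tendsto).comp hx
    have hlq := (tendsto_log_mul differentiableAt_log_one_add_sub_zero (by simp)).comp hx
    have hlq2 := (tendsto_log_pow_mul 1 differentiableAt_log_one_add_sub_zero (by simp)).comp hx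
    have hy := (differentiableAt_evenLogSqPrim_zero.continuousAt.tendsto).comp hx
    have hly := (tendsto_log_mul differentiableAt_evenLogSqPrim_zero evenLogSqPrim_zero).comp hx
    have hy2 := (differentiableAt_evenLogSqPrim₂_zero.continuousAt.tendsto).comp hx
    have hx2 := ((differentiableAt_oddPolylog_zero 2).continuousAt.tendsto).comp hx
    have hlx2 := (tendsto_log_mul (differentiableAt_oddPolylog_zero 2) (oddPolylog_zero 2)).comp hx
    have hx3 := ((differentiableAt_oddPolylog_zero 3).continuousAt.tendsto).comp hx
    -- The products are expanded so that every power of `log` multiplies a function vanishing at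
    -- `0`; for instance `(log z - η)² q²` is treated as `(log z * q - η q)²`. The two
    -- `oddLogSqPrim` limits cancel.
    have h := (((((((tendsto_evenLogCubePrim_one hw hwm).add (tendsto_evenLogCubePrim_one hv hvm)).sub
      (((tendsto_oddLogSqPrim_one hw hwm).sub (tendsto_oddLogSqPrim_one hv hvm)).const_mul
        (2 * η))).sub ((hlq.sub (hq.const_mul η)).pow 2)).add
      (((hly.sub (hy.const_mul η)).sub hy2).const_mul 2)).add
      (((((hlq2.sub (hlq.const_mul (2 * η))).add (hq.const_mul (η ^ 2))).sub
        ((hlx2.sub (hx2.const_mul η)).const_mul 2)).add (hx3.const_mul 2)).const_mul (2 * η))).add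
      ((hq.pow 2).const_mul (η ^ 2))).sub (hq.const_mul (2 * η ^ 3))
    simp only [Function.comp_def] at h
    refine (h.congr fun x => ?_).trans_eq ?_
    · ring
    · simp
      ring_nf

end

section

open Complex

/-! ### Special values -/

theorem I_mem_cutPlane₀₁ : I ∈ cutPlane₀₁ := mem_cutPlane₀₁_of_im_ne_zero (by simp)

theorem neg_I_mem_cutPlane₀₁ : -I ∈ cutPlane₀₁ := mem_cutPlane₀₁_of_im_ne_zero (by simp)

theorem half_mem_cutPlane₀₁ : (1 / 2 : ℂ) ∈ cutPlane₀₁ :=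
  mem_cutPlane₀₁_iff.2 (Or.inl (by norm_num))

theorem one_sub_I_div_one_add_I : (1 - I) / (1 + I) = -I := by
  have h := one_add_ne_zero_of_mem (cutPlane₀₁_subset_cutPlanePM I_mem_cutPlane₀₁)
  rw [div_eq_iff h]
  linear_combination I_sq

theorem one_add_I_div_one_sub_I : (1 + I) / (1 - I) = I := by
  have h := one_sub_ne_zero_of_mem I_mem_cutPlane₀₁.1
  rw [div_eq_iff h]
  linear_combination I_sq

/-- The quotient `(1-i)/(1+i) = -i` and the product `1 - i² = 2` determine both `log (1 ± i)`. -/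
theorem log_one_sub_I : log (1 - I) = (Real.log 2 - Real.pi / 2 * I) / 2 := by
  have h1 := log_cayley (cutPlane₀₁_subset_cutPlanePM I_mem_cutPlane₀₁)
  have h2 := log_one_sub_sq (cutPlane₀₁_subset_cutPlanePM I_mem_cutPlane₀₁)
  rw [one_sub_I_div_one_add_I, log_neg_I] at h1
  rw [I_sq, sub_neg_eq_add, one_add_one_eq_two, ← ofReal_ofNat, ← ofReal_log (by norm_num)] at h2
  linear_combination -h2 / 2 - h1 / 2

theorem log_one_add_I : log (1 + I) = (Real.log 2 + Real.pi / 2 * I) / 2 := by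
  have h1 := log_cayley (cutPlane₀₁_subset_cutPlanePM I_mem_cutPlane₀₁)
  rw [one_sub_I_div_one_add_I, log_neg_I, log_one_sub_I] at h1
  linear_combination h1

theorem log_half : log (1 / 2) = -(Real.log 2 : ℂ) := by
  have h : Real.log (1 / 2) = -Real.log 2 := by rw [one_div, Real.log_inv]
  rw [← ofReal_neg, ← h, ofReal_log (by norm_num)]
  norm_num

theorem log_neg_one_add_I : log (-(1 + I)) = log (1 + I) - Real.pi * I :=
  log_neg_of_im_pos (by simp)

theorem log_neg_one_sub_I : log (-(1 - I)) = log (1 - I) + Real.pi * I := by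
  have h := log_neg_of_im_pos (z := -(1 - I)) (by simp)
  rw [neg_neg] at h
  linear_combination -h

theorem riemannZeta_two_eq {η : ℂ} (hη : η = Real.pi / 2 * I) : riemannZeta 2 = -2 / 3 * η ^ 2 := by
  rw [riemannZeta_two, hη]
  linear_combination (Real.pi : ℂ) ^ 2 / 6 * I_sq

theorem riemannZeta_four_eq {η : ℂ} (hη : η = Real.pi / 2 * I) :
    riemannZeta 4 = 8 / 45 * η ^ 4 := by
  rw [riemannZeta_four, hη]
  linear_combination -(Real.pi : ℂ) ^ 4 / 90 * I_pow_four

theorem polylog_two_half : polylog 2 (1 / 2) = riemannZeta 2 / 2 - (Real.log 2 : ℂ) ^ 2 / 2 := by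
  have h := polylog_two_reflection half_mem_cutPlane₀₁
  rw [show (1 : ℂ) - 1 / 2 = 1 / 2 by norm_num, log_half] at h
  linear_combination h / 2

/-- At `z = 1/2` two of the three arguments coincide and the third is `-1`. -/
theorem polylog_three_half : polylog 3 (1 / 2) = 7 / 8 * riemannZeta 3
    - riemannZeta 2 * (Real.log 2 : ℂ) / 2 + (Real.log 2 : ℂ) ^ 3 / 6 := by
  have h := polylog_three_three_term half_mem_cutPlane₀₁
  have h1 := polylog_neg_one 2 (by norm_num)
  rw [show (1 : ℂ) - 1 / 2 = 1 / 2 by norm_num, show (1 / 2 : ℂ) / (1 / 2 - 1) = -1 by norm_num,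
    log_half] at h
  norm_num at h1 h ⊢
  rw [h1] at h
  linear_combination h / 2

theorem logSqPrim_half : logSqPrim (1 / 2) = riemannZeta 3 / 4 - (Real.log 2 : ℂ) ^ 3 / 3 := by
  have h := logSqPrim_eq half_mem_cutPlane₀₁
  rw [show (1 : ℂ) - 1 / 2 = 1 / 2 by norm_num, log_half, polylog_two_half,
    polylog_three_half] at h
  linear_combination h

theorem logCubePrim_half : logCubePrim (1 / 2) = 6 * polylog 4 (1 / 2) - 6 * riemannZeta 4
    + 21 / 4 * riemannZeta 3 * (Real.log 2 : ℂ)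
    - 3 / 2 * riemannZeta 2 * (Real.log 2 : ℂ) ^ 2 + (Real.log 2 : ℂ) ^ 4 / 2 := by
  have h := logCubePrim_eq half_mem_cutPlane₀₁
  rw [show (1 : ℂ) - 1 / 2 = 1 / 2 by norm_num, log_half, polylog_two_half,
    polylog_three_half] at h
  linear_combination h

theorem neg_one_landen : (-1 : ℂ) / (-1 - 1) = 1 / 2 := by norm_num

theorem log_one_sub_neg_one : log (1 - -1) = (Real.log 2 : ℂ) := by
  rw [sub_neg_eq_add, one_add_one_eq_two, ← ofReal_ofNat, ← ofReal_log (by norm_num)]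

theorem logSqPrim_neg_one : logSqPrim (-1) = riemannZeta 3 / 4 := by
  have h := logSqPrim_landen neg_one_mem_polylogDomain
  rw [neg_one_landen, log_one_sub_neg_one, logSqPrim_half] at h
  linear_combination -h

theorem logCubePrim_neg_one : logCubePrim (-1) = -6 * polylog 4 (1 / 2) + 6 * riemannZeta 4
    - 21 / 4 * riemannZeta 3 * (Real.log 2 : ℂ)
    + 3 / 2 * riemannZeta 2 * (Real.log 2 : ℂ) ^ 2 - (Real.log 2 : ℂ) ^ 4 / 4 := by
  have h := logCubePrim_landen neg_one_mem_polylogDomain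
  rw [neg_one_landen, log_one_sub_neg_one, logCubePrim_half] at h
  linear_combination h

/-- The Landen map sends `-1` to `1/2`, and `1/2` is the fixed point of the reflection, which
therefore determines the value there. -/
theorem logSqPrim₂_neg_one : logSqPrim₂ (-1) = 4 * polylog 4 (1 / 2) - 15 / 4 * riemannZeta 4
    + 7 / 2 * riemannZeta 3 * (Real.log 2 : ℂ)
    - riemannZeta 2 * (Real.log 2 : ℂ) ^ 2 + (Real.log 2 : ℂ) ^ 4 / 6 := by
  have h := logSqPrim₂_landen neg_one_mem_polylogDomain
  have h2 := logSqPrim₂_reflection half_mem_cutPlane₀₁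
  rw [show (1 : ℂ) - 1 / 2 = 1 / 2 by norm_num, log_half, logSqPrim_half] at h2
  rw [neg_one_landen, log_one_sub_neg_one, logSqPrim_neg_one, logCubePrim_neg_one] at h
  linear_combination -h - h2 / 2

/-! ### Conjugate sums at `±i`, `1 ± i` and `(1 ± i)/2` -/

theorem polylog_add_neg_I (n : ℕ) :
    polylog (n + 1) I + polylog (n + 1) (-I) = polylog (n + 1) (-1) / 2 ^ n := by
  rw [polylog_duplication n (cutPlane₀₁_subset_cutPlanePM I_mem_cutPlane₀₁), I_sq]

theorem polylog_two_one_sub_I_add :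
    polylog 2 (1 - I) + polylog 2 (1 + I) = 9 / 4 * riemannZeta 2 + (Real.pi / 2 * I) ^ 2 := by
  have h1 := polylog_two_reflection I_mem_cutPlane₀₁
  have h2 := polylog_two_reflection neg_I_mem_cutPlane₀₁
  have h3 := polylog_add_neg_I 1
  have h4 := polylog_neg_one 1 le_rfl
  rw [log_I, log_one_sub_I] at h1
  rw [log_neg_I, sub_neg_eq_add, log_one_add_I] at h2
  norm_num at h3 h4
  rw [h4] at h3
  linear_combination h1 + h2 - h3

theorem neg_one_add_I_mem_slitPlane : -(1 + I) ∈ slitPlane := by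
  rw [mem_slitPlane_iff]
  simp

theorem neg_one_sub_I_mem_slitPlane : -(1 - I) ∈ slitPlane := by
  rw [mem_slitPlane_iff]
  simp

/-- The three-term relation at `±i` has third arguments `(1 ± i)⁻¹`. Inversion returns these to `1 ±
i`, so adding the two relations gives twice the desired sum. -/
theorem polylog_three_one_sub_I_add {η : ℂ} (hη : η = Real.pi / 2 * I) :
    polylog 3 (1 - I) + polylog 3 (1 + I) = 35 / 32 * riemannZeta 3
      - 1 / 4 * η ^ 2 * (Real.log 2 : ℂ) := by
  have h1 := polylog_three_three_term I_mem_cutPlane₀₁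
  have h2 := polylog_three_three_term neg_I_mem_cutPlane₀₁
  have h3 := polylog_add_neg_I 2
  have h4 := polylog_neg_one 2 (by norm_num)
  have h5 := polylog_three_inversion neg_one_add_I_mem_slitPlane
  have h6 := polylog_three_inversion neg_one_sub_I_mem_slitPlane
  have n1 := one_add_ne_zero_of_mem (cutPlane₀₁_subset_cutPlanePM I_mem_cutPlane₀₁)
  have n2 := one_sub_ne_zero_of_mem I_mem_cutPlane₀₁.1
  have e1 : I / (I - 1) = (1 + I)⁻¹ := by
    rw [div_eq_iff (by rw [← neg_sub]; exact neg_ne_zero.2 n2)]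
    field_simp
    linear_combination I_sq
  have e2 : -I / (-I - 1) = (1 - I)⁻¹ := by
    rw [div_eq_iff (by rw [← neg_add', add_comm]; exact neg_ne_zero.2 n1)]
    field_simp
    linear_combination I_sq
  have hπ : (Real.pi : ℂ) * I = 2 * η := by rw [hη]; ring
  rw [log_I, log_one_sub_I, e1, ← hη] at h1
  rw [log_neg_I, sub_neg_eq_add, log_one_add_I, e2, neg_mul, ← hη] at h2
  rw [log_neg_one_add_I, log_one_add_I, hπ, ← hη] at h5
  rw [log_neg_one_sub_I, log_one_sub_I, hπ, ← hη] at h6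
  norm_num at h3 h4
  rw [h4] at h3
  rw [riemannZeta_two_eq hη] at h1 h2 h5 h6
  linear_combination (h1 + h2 - h3 + h5 + h6) / 2

/-- Both Cayley symmetries are evaluated at `i`. Since `log i = η`, the first loses its
`evenLogSqPrim` and `oddPolylog 2` terms; in the second the two `evenLogSqPrim` contributions cancel
by evenness. -/
theorem polylog_four_one_add_I_add {η : ℂ} (hη : η = Real.pi / 2 * I) :
    polylog 4 (1 - I) + polylog 4 (1 + I) = -5 / 8 * polylog 4 (1 / 2) + 97 / 288 * η ^ 4
      - 5 / 192 * (Real.log 2 : ℂ) ^ 4 - 1 / 6 * η ^ 2 * (Real.log 2 : ℂ) ^ 2 := by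
  have h := evenLogCubePrim_cayley (z := I) (by simp) hη
  have h2 := evenLogSqPrim_cayley I_mem_cutPlane₀₁
  have hx := polylog_three_inversion (z := -I) (by simpa using I_mem_cutPlane₀₁.2)
  have hc := logCubePrim_eq I_mem_cutPlane₀₁
  have hc' := logCubePrim_eq neg_I_mem_cutPlane₀₁
  have hv := logSqPrim_eq I_mem_cutPlane₀₁
  have hv' := logSqPrim_eq neg_I_mem_cutPlane₀₁
  have hη' : -(Real.pi / 2 : ℂ) * I = -η := by rw [hη, neg_mul]
  have hd := polylog_two_one_sub_I_add
  have ht := polylog_three_one_sub_I_add hη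
  rw [one_sub_I_div_one_add_I, one_add_I_div_one_sub_I, log_I, log_one_sub_I, log_one_add_I,
    ← hη] at h
  rw [one_sub_I_div_one_add_I, log_I, log_neg_I, log_one_sub_I, log_one_add_I, hη', ← hη] at h2
  rw [neg_neg, inv_neg, inv_I, neg_neg, log_I, ← hη] at hx
  rw [log_I, log_one_sub_I, ← hη] at hc hv
  rw [log_neg_I, sub_neg_eq_add, log_one_add_I, hη', ← hη] at hc' hv'
  rw [← hη] at hd
  simp only [evenLogCubePrim, oddLogSqPrim, evenLogSqPrim, evenLogSqPrim₂, oddPolylog, neg_neg,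
    neg_sq, I_sq] at h h2
  rw [hc, hc', hv, hv', logCubePrim_neg_one] at h
  rw [logSqPrim₂_neg_one] at h h2
  rw [riemannZeta_two_eq hη] at h h2 hd hx
  rw [riemannZeta_four_eq hη] at h h2
  -- `h - h2` eliminates `evenLogSqPrim₂ i`. The differences of `Li₂` and `Li₃` between `1 - i` and
  -- `1 + i` cancel between the cube and odd-square terms, leaving their sums with coefficients
  -- `2(log² 2 - η²)` and `-8 log 2`, and the `Li₄` sum with coefficient `16`; `hx` removes the odd
  -- `Li₃(i)` term.
  linear_combination (h - h2 - 2 * ((Real.log 2 : ℂ) ^ 2 - η ^ 2) * hd + 8 * Real.log 2 * ht) / 16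
    + η / 4 * hx

theorem one_add_I_mem_polylogDomain : 1 + I ∈ polylogDomain :=
  (mem_cutPlane₀₁_of_im_ne_zero (by simp)).1

theorem half_add_half_I_mem_polylogDomain : 1 / 2 + I / 2 ∈ polylogDomain :=
  (mem_cutPlane₀₁_of_im_ne_zero (by simp)).1

/-- Inversion applied at `1 + i` and `1 - i`, whose inverses are `(1 ∓ i)/2`. -/
theorem polylog_four_half_add_half_I_add {η : ℂ} (hη : η = Real.pi / 2 * I) :
    polylog 4 (1 / 2 + I / 2) + polylog 4 (1 / 2 - I / 2) = 5 / 8 * polylog 4 (1 / 2)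
      + 343 / 2880 * η ^ 4 + 1 / 48 * (Real.log 2 : ℂ) ^ 4
      + 5 / 96 * η ^ 2 * (Real.log 2 : ℂ) ^ 2 := by
  have h := polylog_four_one_add_I_add hη
  have h5 := polylog_four_inversion neg_one_add_I_mem_slitPlane
  have h6 := polylog_four_inversion neg_one_sub_I_mem_slitPlane
  have e1 : (1 + I)⁻¹ = 1 / 2 - I / 2 := by
    refine inv_eq_of_mul_eq_one_right ?_
    linear_combination -I_sq / 2
  have e2 : (1 - I)⁻¹ = 1 / 2 + I / 2 := by
    refine inv_eq_of_mul_eq_one_right ?_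
    linear_combination -I_sq / 2
  have hπ : (Real.pi : ℂ) * I = 2 * η := by rw [hη]; ring
  rw [e1, log_neg_one_add_I, log_one_add_I, hπ, ← hη, riemannZeta_two_eq hη,
    riemannZeta_four_eq hη] at h5
  rw [e2, log_neg_one_sub_I, log_one_sub_I, hπ, ← hη, riemannZeta_two_eq hη,
    riemannZeta_four_eq hη] at h6
  linear_combination h5 + h6 - h

/-- In the binomial expansion only even powers of `i` are real; they are reindexed by half their
exponent. -/
theorem re_one_add_I_pow (k : ℕ) : ((1 + I) ^ k).re
    = ∑ l ∈ Finset.range (k / 2 + 1), (-1 : ℝ) ^ l * (k.choose (2 * l) : ℝ) := by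
  have hterm : ∀ m : ℕ, (I ^ m * 1 ^ (k - m) * (k.choose m : ℂ)).re
      = if Even m then (-1 : ℝ) ^ (m / 2) * (k.choose m : ℝ) else 0 := fun m => by
    rcases Nat.even_or_odd' m with ⟨j, rfl | rfl⟩
    · have h : I ^ (2 * j) = (((-1 : ℝ) ^ j : ℝ) : ℂ) := by
        rw [pow_mul, I_sq]
        push_cast
        rfl
      rw [if_pos (even_two_mul j), h, one_pow, mul_one, re_ofReal_mul, natCast_re,
        Nat.mul_div_cancel_left j two_pos]
    · have h : I ^ (2 * j + 1) = (((-1 : ℝ) ^ j : ℝ) : ℂ) * I := by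
        rw [pow_succ, pow_mul, I_sq]
        push_cast
        rfl
      rw [if_neg (by simp), h, one_pow, mul_one, mul_assoc, re_ofReal_mul]
      simp
  rw [add_comm, add_pow, re_sum, Finset.sum_congr rfl fun m _ => hterm m, ← Finset.sum_filter]
  symm
  refine Finset.sum_nbij (fun l => 2 * l) (fun l hl => ?_) (fun a _ b _ h => by simpa using h)
    (fun m hm => ?_) (fun l _ => ?_)
  · simp only [Finset.mem_filter, Finset.mem_range] at hl ⊢
    exact ⟨by omega, even_two_mul l⟩
  · simp only [Finset.coe_filter, Finset.mem_range, mem_ofPred_eq] at hm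
    obtain ⟨j, rfl⟩ := hm.2.two_dvd
    exact ⟨j, by simp only [Finset.coe_range, mem_Iio]; omega, rfl⟩
  · rw [Nat.mul_div_cancel_left l two_pos]

theorem norm_half_add_half_I_lt_one : ‖(1 / 2 + I / 2 : ℂ)‖ < 1 := by
  rw [← sq_lt_one_iff₀ (norm_nonneg _), ← normSq_eq_norm_sq, normSq_apply]
  norm_num

theorem hasSum_re_polylog_four_half_add_half_I : HasSum
    (fun k : ℕ+ =>
      (∑ l ∈ Finset.range ((k : ℕ) / 2 + 1), (-1 : ℝ) ^ l * ((k : ℕ).choose (2 * l) : ℝ))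
        / (((k : ℕ) : ℝ) ^ 4 * 2 ^ (k : ℕ)))
    (polylog 4 (1 / 2 + I / 2)).re := by
  have h := hasSum_re ((isPolylog_polylog 4).hasSum _ norm_half_add_half_I_lt_one)
  -- The defining series is indexed by `k` in `ℕ` with exponent `k + 1`; this equivalence absorbs
  -- the shift.
  rw [← Equiv.pnatEquivNat.symm.hasSum_iff]
  have e : ∀ k : ℕ, ((1 / 2 + I / 2) ^ (k + 1) / ((k : ℂ) + 1) ^ 4).re
      = (∑ l ∈ Finset.range ((k + 1) / 2 + 1), (-1 : ℝ) ^ l * ((k + 1).choose (2 * l) : ℝ))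
        / (((k + 1 : ℕ) : ℝ) ^ 4 * 2 ^ (k + 1)) := fun k => by
    have h1 : (1 / 2 + I / 2) ^ (k + 1) / ((k : ℂ) + 1) ^ 4
        = (1 + I) ^ (k + 1) / (((((k + 1 : ℕ) : ℝ) ^ 4 * 2 ^ (k + 1) : ℝ)) : ℂ) := by
      rw [← add_div, div_pow, div_div, mul_comm ((2 : ℂ) ^ (k + 1))]
      push_cast
      rfl
    rw [h1, div_ofReal_re, re_one_add_I_pow]
  rw [funext e] at h
  exact h

end

/-! ### The two real parts -/

theorem proposition9 :
    (((polylog 4 (1 + Complex.I)).re : ℝ) : ℂ)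
        = -(5 * polylog 4 (1 / 2)) / 16
          + ((97 * Real.pi ^ 4 / 9216 - 5 * Real.log 2 ^ 4 / 384
              + 1 / 48 * Real.pi ^ 2 * Real.log 2 ^ 2 : ℝ) : ℂ) ∧
    HasSum
        (fun k : ℕ+ =>
          (∑ l ∈ Finset.range ((k : ℕ) / 2 + 1), (-1 : ℝ) ^ l * ((k : ℕ).choose (2 * l) : ℝ))
            / (((k : ℕ) : ℝ) ^ 4 * 2 ^ (k : ℕ)))
        (polylog 4 (1 / 2 + Complex.I / 2)).re ∧
    (((polylog 4 (1 / 2 + Complex.I / 2)).re : ℝ) : ℂ)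
        = 5 * polylog 4 (1 / 2) / 16
          + ((343 * Real.pi ^ 4 / 92160 + Real.log 2 ^ 4 / 96
              - 5 / 768 * Real.pi ^ 2 * Real.log 2 ^ 2 : ℝ) : ℂ) := by
  have h2 : (Real.pi / 2 * Complex.I) ^ 2 = -((Real.pi : ℂ) ^ 2 / 4) := by
    linear_combination (Real.pi : ℂ) ^ 2 / 4 * Complex.I_sq
  have h4 : (Real.pi / 2 * Complex.I) ^ 4 = (Real.pi : ℂ) ^ 4 / 16 := by
    linear_combination (Real.pi : ℂ) ^ 4 / 16 * Complex.I_pow_four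
  refine ⟨?_, hasSum_re_polylog_four_half_add_half_I, ?_⟩
  · have h := polylog_four_one_add_I_add rfl
    have hc := polylog_conj 3 one_add_I_mem_polylogDomain
    have e : (starRingEnd ℂ) (1 + Complex.I) = 1 - Complex.I := by simp [sub_eq_add_neg]
    rw [e] at hc
    -- A value plus its conjugate is twice its real part, and conjugation symmetry identifies the
    -- conjugate with `Li₄(1-i)`.
    have hr := Complex.add_conj (polylog 4 (1 + Complex.I))
    rw [← hc, add_comm, h, h2, h4] at hr
    push_cast at hr ⊢
    linear_combination -hr / 2
  · have h := polylog_four_half_add_half_I_add rfl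
    have hc := polylog_conj 3 half_add_half_I_mem_polylogDomain
    have e : (starRingEnd ℂ) (1 / 2 + Complex.I / 2) = 1 / 2 - Complex.I / 2 := by
      rw [map_add, map_div₀, map_div₀, Complex.conj_I, map_ofNat, map_one]
      ring
    rw [e] at hc
    have hr := Complex.add_conj (polylog 4 (1 / 2 + Complex.I / 2))
    rw [← hc, h, h2, h4] at hr
    push_cast at hr ⊢
    linear_combination -hr / 2
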